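/- **Model.** $T=(V,E,w)$ is a finite tree with edge weights $w:E\to\mathbb R_{>0}$ and a homebase $r\in V$, and $q\ge 0$ is the invoking cost. Initially no agent is present. A strategy is a finite sequence of moves; one move either invokes a new agent in $r$, or lets one agent already present traverse an edge incident to the vertex that it occupies. It explores $T$ if every vertex (including $r$) is visited by some agent; agents need not return to $r$. Its cost is $kq+\sum_{i=1}^k d_i$, where $k$ is the number of invoked agents and $d_i$ the distance traversed by the $i$-th one. $\mathcal S^{opt}_q(T)$ denotes the minimum cost of a strategy that explores $T$ (the off-line optimum). An on-line strategy $\mathcal S$ is a deterministic rule that determines the next move (or the end of the strategy) from the information obtained so far, namely the past moves together with, for each vertex visited so far, its incident edges, their weights and the names of their other ends; it has to explore every tree $T$ (for every homebase). $\mathcal S_q(T)$ is its cost on $T$, and $r_q(\mathcal S)=\sup_T \mathcal S_q(T)/\mathcal S^{opt}_q(T)$ its competitive ratio (with $0/0=0$, which only concerns the one-vertex tree with $q=0$). $DFS'$ is depth-first search by a single agent that stops as soon as all vertices are explored: the agent goes to an arbitrary unexplored neighbour of its current vertex if there is one, and otherwise back to the parent of the current vertex. For an integer $l\ge 1$ let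 $\mathcal T_l$ be the class of trees with all edge weights $1$ that consist of a path (spine) of length $l(l+1)$ starting in the homebase $v_0$, and, for each $i\in\{1,\dots,l\}$, of a side path of some length $l_i\in\{1,\dots,l\}$ attached to the vertex $v_i$ of the spine at distance $il$ from $v_0$. **Theorem.** Let $q\ge 0$. 1. $DFS'$ (with every rule for the choice among unexplored neighbours) is an on-line strategy with $r_q(DFS')\le 2$. 2. For every $\varepsilon>0$ there is an $L$ (depending only on $q$ and $\varepsilon$) such that for every $l\ge L$ and every on-line strategy $\mathcal S$ there is a tree $T\in\mathcal T_l$ with $\mathcal S_q(T)\ge(2-\varepsilon)\,\mathcal S^{opt}_q(T)$. 3. Consequently the least competitive ratio of an on-line strategy for trees is exactly $2$: every on-line strategy $\mathcal S$ has $r_q(\mathcal S)\ge 2$, and equality is attained. -/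

import Mathlib

open scoped ENNReal

/-- A finite edge-weighted tree with positive real weights and a distinguished homebase (the root).
Vertices are named by natural numbers; `tree` is a subgraph of the complete graph on `ℕ`. -/
structure WTree where
  tree : (⊤ : SimpleGraph ℕ).Subgraph
  finite : tree.verts.Finite
  isTree : tree.coe.IsTree
  weight : Sym2 ℕ → ℝ
  weight_pos : ∀ e ∈ tree.edgeSet, 0 < weight e
  home : ℕ
  home_mem : home ∈ tree.verts

/-- A move: invoking a new agent in the homebase, or the traversal by agent `a` of the edge from
its current vertex to the adjacent vertex `v`. Agents are numbered `0, 1, 2, …` in the order in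
which they are invoked. One move is made per step. -/
inductive Move where
  | invoke : Move
  | traverse (a v : ℕ) : Move

/-- `Legal T pos ms`: the moves `ms` can be performed on `T`, one after another, when agent `a`
occupies `pos[a]` at the beginning. -/
def Legal (T : WTree) : List ℕ → List Move → Prop
  | _, [] => True
  | pos, Move.invoke :: ms => Legal T (pos ++ [T.home]) ms
  | pos, Move.traverse a v :: ms =>
      (∃ u, pos[a]? = some u ∧ T.tree.Adj u v) ∧ Legal T (pos.set a v) ms

/-- The total distance traversed by all agents during `ms`, when agent `a` occupies `pos[a]` at
the beginning. (The value `0` for an agent that was not invoked is never used for legal moves.) -/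
noncomputable def totalDistance (T : WTree) : List ℕ → List Move → ℝ
  | _, [] => 0
  | pos, Move.invoke :: ms => totalDistance T (pos ++ [T.home]) ms
  | pos, Move.traverse a v :: ms =>
      (match pos[a]? with
        | some u => T.weight s(u, v)
        | none => 0) + totalDistance T (pos.set a v) ms

/-- The number of agents invoked by a sequence of moves. -/
def numAgents : List Move → ℕ
  | [] => 0
  | Move.invoke :: ms => numAgents ms + 1
  | Move.traverse _ _ :: ms => numAgents ms

/-- The cost: the invoking cost `q` for each agent, plus the total distance. -/
noncomputable def cost (q : ℝ) (T : WTree) (ms : List Move) : ℝ :=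
  (numAgents ms : ℝ) * q + totalDistance T [] ms

/-- The vertex of `T` reached by a move. -/
def reached (T : WTree) : Move → ℕ
  | Move.invoke => T.home
  | Move.traverse _ v => v

/-- `ms` is an (off-line) exploration strategy for `T`: a legal sequence of moves, starting with no
agent present, such that each vertex is visited by some agent. -/
def Explores (T : WTree) (ms : List Move) : Prop :=
  Legal T [] ms ∧ ∀ x ∈ T.tree.verts, ∃ m ∈ ms, reached T m = x

/-- The cost of a cost-optimal off-line strategy for `T`. -/
noncomputable def optCost (q : ℝ) (T : WTree) : ℝ :=
  sInf {c : ℝ | ∃ ms, Explores T ms ∧ cost q T ms = c}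

/-- What becomes known with one move: the move itself, the vertex reached by it, and the edges
incident to this vertex, each given as the name of the other end and the length. -/
structure Event where
  move : Move
  vertex : ℕ
  star : Set (ℕ × ℝ)

/-- The information obtained on `T` by a move. -/
def observe (T : WTree) (m : Move) : Event where
  move := m
  vertex := reached T m
  star := {p | T.tree.Adj (reached T m) p.1 ∧ p.2 = T.weight s(reached T m, p.1)}

/-- All the information available after the moves `ms` on `T` (agents communicate freely). -/
def history (T : WTree) (ms : List Move) : List Event := ms.map (observe T)

/-- The decision rule `next` (`none` means stop), applied on the unknown tree `T`, performs exactly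
the moves `ms` and then stops. -/
def Performs (next : List Event → Option Move) (T : WTree) (ms : List Move) : Prop :=
  (∀ (i : ℕ) (hi : i < ms.length), next (history T (ms.take i)) = some ms[i]) ∧
    next (history T ms) = none

/-- A deterministic on-line strategy for trees: each decision is a function of the information
collected so far, and every tree is explored. -/
structure OnlineStrategy where
  next : List Event → Option Move
  explores : ∀ T : WTree, ∃ ms, Performs next T ms ∧ Explores T ms

/-- The moves performed by an on-line strategy on `T`. -/
noncomputable def OnlineStrategy.moves (S : OnlineStrategy) (T : WTree) : List Move :=
  (S.explores T).choose

/-- The cost of an on-line strategy on `T`. -/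
noncomputable def OnlineStrategy.costOn (S : OnlineStrategy) (q : ℝ) (T : WTree) : ℝ :=
  cost q T (S.moves T)

/-- The competitive ratio, the supremum over all trees of on-line cost over optimal cost. The
optimal cost vanishes only if `q = 0` and `T` has one vertex; then the on-line cost vanishes too, and
`0 / 0 = 0` in `ℝ≥0∞`. -/
noncomputable def competitiveRatio (q : ℝ) (S : OnlineStrategy) : ℝ≥0∞ :=
  ⨆ T : WTree, ENNReal.ofReal (S.costOn q T) / ENNReal.ofReal (optCost q T)

/-- The vertex `x` was visited during `h`. -/
def Visited (h : List Event) (x : ℕ) : Prop := ∃ e ∈ h, e.vertex = x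

/-- `p` is the vertex from which the agent that makes the walk `h` entered `c` for the first
time. -/
def IsDFSParent (h : List Event) (c p : ℕ) : Prop :=
  ∃ (h₁ h₂ : List Event) (e₁ e₂ : Event), h = h₁ ++ e₁ :: e₂ :: h₂ ∧
    e₁.vertex = p ∧ e₂.vertex = c ∧ ¬ Visited (h₁ ++ [e₁]) c

/-- Depth-first search by one agent without the return to the homebase: the agent goes to an
unvisited neighbour of its vertex if there is one (any of them); otherwise it goes back to the parent,
or stops at once if no known vertex is unvisited. -/
def IsDFSWithoutReturn (next : List Event → Option Move) : Prop :=
  next [] = some Move.invoke ∧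
  ∀ (h : List Event) (e : Event),
    ((∃ p ∈ e.star, ¬ Visited (h ++ [e]) p.1) →
      ∃ p ∈ e.star, ¬ Visited (h ++ [e]) p.1 ∧ next (h ++ [e]) = some (Move.traverse 0 p.1)) ∧
    ((∀ p ∈ e.star, Visited (h ++ [e]) p.1) →
      (∃ f ∈ h, ∃ p ∈ f.star, ¬ Visited (h ++ [e]) p.1) →
      ∀ u, IsDFSParent (h ++ [e]) e.vertex u → next (h ++ [e]) = some (Move.traverse 0 u)) ∧
    ((∀ f ∈ h ++ [e], ∀ p ∈ f.star, Visited (h ++ [e]) p.1) → next (h ++ [e]) = none)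

/-- A spine `0, 1, …, l (l + 1)`, and for each `i < l` a side path with `len i` vertices. -/
abbrev SpineVertex (l : ℕ) (len : Fin l → ℕ) : Type :=
  Fin (l * (l + 1) + 1) ⊕ (Σ i : Fin l, Fin (len i))

/-- Consecutive vertices of the spine and of each side path are adjacent, and the first vertex of
the side path `i` is adjacent to the vertex `(i + 1) l` of the spine. -/
def spineGraph (l : ℕ) (len : Fin l → ℕ) : SimpleGraph (SpineVertex l len) :=
  SimpleGraph.fromRel fun x y =>
    match x, y with
    | Sum.inl s, Sum.inl t => (s : ℕ) + 1 = t
    | Sum.inl s, Sum.inr ⟨i, j⟩ => (s : ℕ) = ((i : ℕ) + 1) * l ∧ (j : ℕ) = 0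
    | Sum.inr ⟨i, j⟩, Sum.inr ⟨i', j'⟩ => i = i' ∧ (j : ℕ) + 1 = j'
    | Sum.inr _, Sum.inl _ => False

/-- `T` is a unit-weight tree that consists of a spine of `l + 1` segments of length `l`, with the
homebase at one end, and of one side path of length between `1` and `l` at each of the `l` vertices
where two segments meet. -/
def IsSpineTree (l : ℕ) (T : WTree) : Prop :=
  1 ≤ l ∧ ∃ len : Fin l → ℕ, (∀ i, 1 ≤ len i ∧ len i ≤ l) ∧
    (∃ φ : spineGraph l len ≃g T.tree.coe, ((φ (Sum.inl 0) : T.tree.verts) : ℕ) = T.home) ∧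
    ∀ e ∈ T.tree.edgeSet, T.weight e = 1

/-! Upper bound. Let `W` be the total weight. Every exploring strategy invokes an agent and crosses
each edge, so the optimum is at least `q + W` (`RootedBy.le_optCost`). Depth-first search enters
each vertex from its parent once and returns at most once, so it pays at most `q + 2 * W`, which is
at most twice the optimum. The invariant is `DFSState`.

Lower bound. At each of the `l` branching vertices the adversary presents two branches that look
alike, and waits until both are occupied at once or depth `l` is reached in one of them. Just before
that move some branch is empty (`exists_empty_branch`). It becomes the side path and ends at its
first unvisited vertex; the other branch continues the spine. Nothing seen so far contradicts this
choice, so the strategy behaves alike on all trees that respect it (`exists_stage_choice`).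

Side paths: every edge but the last was crossed down and up before the decision. It is crossed again
to reach the end, and once more unless an agent finishes in the path (`side_crossings`). Agents that
finish in different side paths are different, and each has crossed all of segment 0, whose length
`l` is at least that of any side path; this pays for the missing fourth crossings
(`card_le_branchCrossings`).

Spine: for each stage, either its own segment is crossed twice throughout, or all earlier segments
are (`spine_crossings`). Hence at most one of the segments `1, …, l` is deficient.

With `K` the total length of the side paths, the distance is at least `2 * l ^ 2 + 4 * K - 6 * l`
(`le_totalDistance`). One agent that visits each side path on its way along the spine pays `q + l *
(l + 1) + 2 * K` (`optCost_branchTree_le`). Twice the latter exceeds the former by only `2 * q + 8 *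
l`, which is negligible against `l ^ 2`. -/

/-! ### Rooted trees described by a parent function -/

/-- `par` maps each vertex of `T` other than the homebase to its parent, and `rk` decreases along
`par`. -/
structure RootedBy (T : WTree) (par rk : ℕ → ℕ) : Prop where
  par_home : par T.home = T.home
  par_mem : ∀ v ∈ T.tree.verts, par v ∈ T.tree.verts
  rk_lt : ∀ v ∈ T.tree.verts, v ≠ T.home → rk (par v) < rk v
  adj_iff : ∀ u v, T.tree.Adj u v ↔ u ∈ T.tree.verts ∧ v ∈ T.tree.verts ∧
    ((v ≠ T.home ∧ par v = u) ∨ (u ≠ T.home ∧ par u = v))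

/-- The parent is the penultimate vertex of the unique path from the homebase, and the rank is the
length of that path. By acyclicity, for two adjacent vertices one of these paths extends the other
by their edge. -/
theorem WTree.exists_rootedBy (T : WTree) : ∃ par rk, RootedBy T par rk := by
  classical
  set G := T.tree.coe with hG
  let r : T.tree.verts := ⟨T.home, T.home_mem⟩
  have hT : G.IsTree := T.isTree
  choose p hp hpu using fun v => hT.existsUnique_path r v
  have hpr : p r = SimpleGraph.Walk.nil := (hpu r _ SimpleGraph.Walk.IsPath.nil).symm
  let P : T.tree.verts → T.tree.verts := fun v => (p v).penultimate
  have hnil : ∀ v, v ≠ r → ¬ (p v).Nil := fun v hv hn => hv hn.eq.symm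
  have hPadj : ∀ v, v ≠ r → G.Adj (P v) v := fun v hv =>
    SimpleGraph.Walk.adj_penultimate (hnil v hv)
  have hPlen : ∀ v, v ≠ r → (p (P v)).length + 1 = (p v).length := by
    intro v hv
    have h1 : (p v).dropLast = p (P v) :=
      hpu _ _ ((hp v).dropLast)
    rw [← h1, SimpleGraph.Walk.length_dropLast_add_one (hnil v hv)]
  let par : ℕ → ℕ := fun x => if h : x ∈ T.tree.verts then P ⟨x, h⟩ else x
  let rk : ℕ → ℕ := fun x => if h : x ∈ T.tree.verts then (p ⟨x, h⟩).length else 0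
  have hpar : ∀ v (hv : v ∈ T.tree.verts), par v = P ⟨v, hv⟩ := fun v hv => dif_pos hv
  have hrk : ∀ v (hv : v ∈ T.tree.verts), rk v = (p ⟨v, hv⟩).length := fun v hv => dif_pos hv
  refine ⟨par, rk, ?_, ?_, ?_, ?_⟩
  · rw [hpar _ T.home_mem]
    change ((p r).penultimate : ℕ) = _
    rw [hpr]; rfl
  · intro v hv
    rw [hpar v hv]
    exact Subtype.coe_prop _
  · intro v hv hne
    have := hPlen ⟨v, hv⟩ (fun h => hne (congrArg Subtype.val h))
    rw [hpar v hv, hrk v hv, hrk _ (P ⟨v, hv⟩).2]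
    exact Nat.lt_of_succ_le this.le
  · intro u v
    constructor
    · intro h
      have hu := T.tree.edge_vert h
      have hv := T.tree.edge_vert h.symm
      refine ⟨hu, hv, ?_⟩
      have hadj : G.Adj ⟨u, hu⟩ ⟨v, hv⟩ := h
      rw [hpar u hu, hpar v hv]
      by_cases hs : (⟨u, hu⟩ : T.tree.verts) ∈ (p ⟨v, hv⟩).support
      · left
        have := hT.isAcyclic.eq_penultimate_of_adj_end (hp _) hadj.symm hs
        refine ⟨?_, (congrArg Subtype.val this).symm⟩
        rintro rfl
        change _ ∈ (p r).support at hs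
        rw [hpr] at hs
        simp only [SimpleGraph.Walk.support_nil, List.mem_singleton] at hs
        exact hadj.ne hs
      · right
        have hs' := hT.isAcyclic.mem_support_of_ne_mem_support_of_adj_of_isPath
          (hp ⟨u, hu⟩) (hp ⟨v, hv⟩) hadj hs
        have := hT.isAcyclic.eq_penultimate_of_adj_end (hp _) hadj hs'
        refine ⟨?_, (congrArg Subtype.val this).symm⟩
        rintro rfl
        change _ ∈ (p r).support at hs'
        rw [hpr] at hs'
        simp only [SimpleGraph.Walk.support_nil, List.mem_singleton] at hs'
        exact hadj.ne hs'.symm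
    · rintro ⟨hu, hv, ⟨hne, h⟩ | ⟨hne, h⟩⟩
      · rw [hpar v hv] at h
        have := hPadj ⟨v, hv⟩ (fun h => hne (congrArg Subtype.val h))
        have h2 : T.tree.Adj (P ⟨v, hv⟩) v := this
        rwa [h] at h2
      · rw [hpar u hu] at h
        have := hPadj ⟨u, hu⟩ (fun h => hne (congrArg Subtype.val h))
        have h2 : T.tree.Adj (P ⟨u, hu⟩) u := this
        rw [h] at h2
        exact h2.symm

/-- The subgraph with vertex set `V` in which each vertex other than `home` is joined to its
parent. -/
def parentSubgraph (V : Set ℕ) (home : ℕ) (par : ℕ → ℕ) (hpar : ∀ v ∈ V, v ≠ home → par v ≠ v) :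
    (⊤ : SimpleGraph ℕ).Subgraph where
  verts := V
  Adj u v := u ∈ V ∧ v ∈ V ∧ ((v ≠ home ∧ par v = u) ∨ (u ≠ home ∧ par u = v))
  adj_sub := by
    rintro u v ⟨hu, hv, ⟨h, rfl⟩ | ⟨h, rfl⟩⟩
    · exact hpar v hv h
    · exact (hpar u hu h).symm
  edge_vert := fun h => h.1
  symm := ⟨fun u v ⟨hu, hv, h⟩ => ⟨hv, hu, h.symm⟩⟩

/-- Following parents lowers the rank until `home` is reached, which gives connectedness. Sending a
vertex to its parent edge is a surjection from the vertices other than `home` onto the edges, so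
there are few enough edges for a tree. -/
theorem parentSubgraph_isTree {V : Set ℕ} {home : ℕ} {par rk : ℕ → ℕ} (hV : V.Finite)
    (hhome : home ∈ V) (hmem : ∀ v ∈ V, par v ∈ V) (hrk : ∀ v ∈ V, v ≠ home → rk (par v) < rk v)
    (hpar : ∀ v ∈ V, v ≠ home → par v ≠ v) :
    (parentSubgraph V home par hpar).coe.IsTree := by
  classical
  set G := (parentSubgraph V home par hpar).coe with hG
  have : Finite (parentSubgraph V home par hpar).verts := hV
  have hreach : ∀ n, ∀ v (hv : v ∈ V), rk v ≤ n → G.Reachable ⟨v, hv⟩ ⟨home, hhome⟩ := by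
    intro n
    induction n with
    | zero =>
      intro v hv h
      by_cases hne : v = home
      · subst hne; rfl
      · have := hrk v hv hne; omega
    | succ n ih =>
      intro v hv h
      by_cases hne : v = home
      · subst hne; rfl
      · have h1 := hrk v hv hne
        have h2 := ih (par v) (hmem v hv) (by omega)
        refine SimpleGraph.Reachable.trans (SimpleGraph.Adj.reachable ?_) h2
        exact ⟨hv, hmem v hv, Or.inr ⟨hne, rfl⟩⟩
  have hconn : G.Connected := by
    have : Nonempty (parentSubgraph V home par hpar).verts := ⟨⟨home, hhome⟩⟩
    refine SimpleGraph.Connected.mk fun u v => ?_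
    exact (hreach _ u.1 u.2 le_rfl).trans (hreach _ v.1 v.2 le_rfl).symm
  rw [SimpleGraph.isTree_iff_connected_and_card]
  refine ⟨hconn, le_antisymm ?_ hconn.card_vert_le_card_edgeSet_add_one⟩
  let r : (parentSubgraph V home par hpar).verts := ⟨home, hhome⟩
  let f : {v : (parentSubgraph V home par hpar).verts // v ≠ r} → G.edgeSet := fun v =>
    ⟨s(v.1, ⟨par v.1.1, hmem v.1.1 v.1.2⟩), by
      rw [SimpleGraph.mem_edgeSet]
      exact ⟨v.1.2, hmem v.1.1 v.1.2, Or.inr ⟨fun h => v.2 (Subtype.ext h), rfl⟩⟩⟩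
  have hf : Function.Surjective f := by
    rintro ⟨e, he⟩
    induction e using Sym2.ind with
    | _ x y =>
      rw [SimpleGraph.mem_edgeSet] at he
      obtain ⟨hx, hy, ⟨hne, h⟩ | ⟨hne, h⟩⟩ := he
      · refine ⟨⟨y, fun h => hne (congrArg Subtype.val h)⟩, Subtype.ext ?_⟩
        change s(y, _) = s(x, y)
        rw [Sym2.eq_swap]
        exact congrArg₂ (fun a b => s(a, b)) (Subtype.ext h) rfl
      · refine ⟨⟨x, fun h => hne (congrArg Subtype.val h)⟩, Subtype.ext ?_⟩
        change s(x, _) = s(x, y)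
        exact congrArg₂ (fun a b => s(a, b)) rfl (Subtype.ext h)
  have h1 := Nat.card_le_card_of_surjective f hf
  have := Fintype.ofFinite (parentSubgraph V home par hpar).verts
  have h2 : Nat.card {v : (parentSubgraph V home par hpar).verts // v ≠ r} + 1 =
      Nat.card (parentSubgraph V home par hpar).verts := by
    simp only [Nat.card_eq_fintype_card]
    rw [Fintype.card_subtype_compl, Fintype.card_subtype_eq]
    exact Nat.sub_add_cancel (Fintype.card_pos_iff.mpr ⟨r⟩)
  omega

/-- The unit-weight tree with a given parent function. -/
noncomputable def WTree.ofParent (V : Set ℕ) (home : ℕ) (par rk : ℕ → ℕ) (hV : V.Finite)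
    (hhome : home ∈ V) (hmem : ∀ v ∈ V, par v ∈ V)
    (hrk : ∀ v ∈ V, v ≠ home → rk (par v) < rk v) : WTree where
  tree := parentSubgraph V home par fun v hv hne h => by
    have := hrk v hv hne
    rw [h] at this
    exact this.false
  finite := hV
  isTree := parentSubgraph_isTree hV hhome hmem hrk _
  weight := fun _ => 1
  weight_pos := fun _ _ => one_pos
  home := home
  home_mem := hhome

theorem WTree.ofParent_rootedBy {V : Set ℕ} {home : ℕ} {par rk : ℕ → ℕ} (hV : V.Finite)
    (hhome : home ∈ V) (hmem : ∀ v ∈ V, par v ∈ V)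
    (hrk : ∀ v ∈ V, v ≠ home → rk (par v) < rk v) (hpar : par home = home) :
    RootedBy (WTree.ofParent V home par rk hV hhome hmem hrk) par rk where
  par_home := hpar
  par_mem := hmem
  rk_lt := hrk
  adj_iff := fun _ _ => Iff.rfl

/-! ### Positions and edge crossings -/

/-- The positions of the agents after the moves. -/
def endPos (home : ℕ) : List ℕ → List Move → List ℕ
  | pos, [] => pos
  | pos, Move.invoke :: ms => endPos home (pos ++ [home]) ms
  | pos, Move.traverse a v :: ms => endPos home (pos.set a v) ms

/-- The number of traversals of the edge `e`. -/
def crossings (home : ℕ) (e : Sym2 ℕ) : List ℕ → List Move → ℕ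
  | _, [] => 0
  | pos, Move.invoke :: ms => crossings home e (pos ++ [home]) ms
  | pos, Move.traverse a v :: ms =>
      (if (pos[a]?).map (fun u => s(u, v)) = some e then 1 else 0) +
        crossings home e (pos.set a v) ms

theorem endPos_append (home : ℕ) (pos : List ℕ) (m₁ m₂ : List Move) :
    endPos home pos (m₁ ++ m₂) = endPos home (endPos home pos m₁) m₂ := by
  induction m₁ generalizing pos with
  | nil => rfl
  | cons m ms ih => cases m <;> simp [endPos, ih]

theorem crossings_append (home : ℕ) (e : Sym2 ℕ) (pos : List ℕ) (m₁ m₂ : List Move) :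
    crossings home e pos (m₁ ++ m₂) =
      crossings home e pos m₁ + crossings home e (endPos home pos m₁) m₂ := by
  induction m₁ generalizing pos with
  | nil => simp [crossings, endPos]
  | cons m ms ih => cases m <;> simp [endPos, crossings, ih, add_assoc]

theorem legal_append (T : WTree) (pos : List ℕ) (m₁ m₂ : List Move) :
    Legal T pos (m₁ ++ m₂) ↔ Legal T pos m₁ ∧ Legal T (endPos T.home pos m₁) m₂ := by
  induction m₁ generalizing pos with
  | nil => simp [Legal, endPos]
  | cons m ms ih => cases m <;> simp [endPos, Legal, ih, and_assoc]

theorem totalDistance_append (T : WTree) (pos : List ℕ) (m₁ m₂ : List Move) :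
    totalDistance T pos (m₁ ++ m₂) =
      totalDistance T pos m₁ + totalDistance T (endPos T.home pos m₁) m₂ := by
  induction m₁ generalizing pos with
  | nil => simp [totalDistance, endPos]
  | cons m ms ih => cases m <;> simp [endPos, totalDistance, ih, add_assoc]

theorem numAgents_append (m₁ m₂ : List Move) :
    numAgents (m₁ ++ m₂) = numAgents m₁ + numAgents m₂ := by
  induction m₁ with
  | nil => simp [numAgents]
  | cons m ms ih => cases m <;> simp [numAgents, ih]; omega

theorem totalDistance_nonneg {T : WTree} {pos : List ℕ} {ms : List Move} (h : Legal T pos ms) :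
    0 ≤ totalDistance T pos ms := by
  induction ms generalizing pos with
  | nil => simp [totalDistance]
  | cons m ms ih =>
    cases m with
    | invoke => exact ih h
    | traverse a v =>
      obtain ⟨⟨u, hu, hadj⟩, h⟩ := h
      simp only [totalDistance, hu]
      exact add_nonneg (T.weight_pos _ hadj).le (ih h)

theorem endPos_mem_verts {T : WTree} {pos : List ℕ} {ms : List Move} (h : Legal T pos ms)
    (hpos : ∀ x ∈ pos, x ∈ T.tree.verts) : ∀ x ∈ endPos T.home pos ms, x ∈ T.tree.verts := by
  induction ms generalizing pos with
  | nil => exact hpos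
  | cons m ms ih =>
    cases m with
    | invoke =>
      refine ih h fun x hx => ?_
      rw [List.mem_append, List.mem_singleton] at hx
      exact hx.elim (hpos x) fun hx => hx ▸ T.home_mem
    | traverse a v =>
      obtain ⟨⟨u, hu, hadj⟩, h⟩ := h
      refine ih h fun x hx => ?_
      rcases List.mem_or_eq_of_mem_set hx with hx | rfl
      · exact hpos x hx
      · exact T.tree.edge_vert hadj.symm

/-- A vertex reached during legal moves is occupied at some time. -/
theorem exists_split_of_reached {T : WTree} {pos : List ℕ} {ms : List Move} {x : ℕ}
    (h : Legal T pos ms) (hx : ∃ m ∈ ms, reached T m = x) :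
    ∃ m₁ m₂, ms = m₁ ++ m₂ ∧ x ∈ endPos T.home pos m₁ := by
  induction ms generalizing pos with
  | nil => simp at hx
  | cons m ms ih =>
    by_cases hr : reached T m = x
    · refine ⟨[m], ms, rfl, ?_⟩
      cases m with
      | invoke => simp [endPos, reached] at hr ⊢; exact Or.inr hr.symm
      | traverse a v =>
        obtain ⟨⟨u, hu, hadj⟩, h⟩ := h
        obtain rfl : v = x := hr
        have ha : a < pos.length := (List.getElem?_eq_some_iff.1 hu).1
        simpa [endPos] using List.mem_set ha v
    · have hx' : ∃ m ∈ ms, reached T m = x := by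
        obtain ⟨m', hm', hh⟩ := hx
        rcases List.mem_cons.1 hm' with rfl | hm'
        · exact absurd hh hr
        · exact ⟨m', hm', hh⟩
      cases m with
      | invoke =>
        obtain ⟨m₁, m₂, rfl, hm⟩ := ih (pos := pos ++ [T.home]) h hx'
        exact ⟨Move.invoke :: m₁, m₂, rfl, hm⟩
      | traverse a v =>
        obtain ⟨m₁, m₂, rfl, hm⟩ := ih (pos := pos.set a v) h.2 hx'
        exact ⟨Move.traverse a v :: m₁, m₂, rfl, hm⟩

/-- Occupied vertices were reached. -/
theorem reached_of_mem_endPos {T : WTree} {pos : List ℕ} {ms : List Move} {x : ℕ}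
    (hx : x ∈ endPos T.home pos ms) : x ∈ pos ∨ ∃ m ∈ ms, reached T m = x := by
  induction ms generalizing pos with
  | nil => exact Or.inl hx
  | cons m ms ih =>
    cases m with
    | invoke =>
      rcases ih hx with h | ⟨m, hm, h⟩
      · rw [List.mem_append, List.mem_singleton] at h
        exact h.imp_right fun h => ⟨_, List.mem_cons_self, h.symm⟩
      · exact Or.inr ⟨m, List.mem_cons_of_mem _ hm, h⟩
    | traverse a v =>
      rcases ih hx with h | ⟨m, hm, h⟩
      · rcases List.mem_or_eq_of_mem_set h with h | rfl
        · exact Or.inl h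
        · exact Or.inr ⟨_, List.mem_cons_self, rfl⟩
      · exact Or.inr ⟨m, List.mem_cons_of_mem _ hm, h⟩

/-- The number of agents in `D`. -/
noncomputable def agentsIn (D : Set ℕ) (pos : List ℕ) : ℕ :=
  open Classical in pos.countP (· ∈ D)

theorem agentsIn_nil (D : Set ℕ) : agentsIn D [] = 0 := rfl

theorem agentsIn_pos_iff {D : Set ℕ} {pos : List ℕ} : 0 < agentsIn D pos ↔ ∃ x ∈ pos, x ∈ D := by
  simp [agentsIn, List.countP_pos_iff]

theorem agentsIn_eq_zero_iff {D : Set ℕ} {pos : List ℕ} :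
    agentsIn D pos = 0 ↔ ∀ x ∈ pos, x ∉ D := by
  simp [agentsIn, List.countP_eq_zero]

theorem agentsIn_add_le {D₁ D₂ D : Set ℕ} (h₁ : D₁ ⊆ D) (h₂ : D₂ ⊆ D) (hd : Disjoint D₁ D₂)
    (pos : List ℕ) : agentsIn D₁ pos + agentsIn D₂ pos ≤ agentsIn D pos := by
  classical
  induction pos with
  | nil => simp [agentsIn]
  | cons x pos ih =>
    simp only [agentsIn, List.countP_cons, decide_eq_true_eq] at ih ⊢
    have : x ∈ D₁ → x ∉ D₂ := fun h => Set.disjoint_left.1 hd h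
    by_cases a : x ∈ D₁ <;> by_cases b : x ∈ D₂ <;> by_cases c : x ∈ D <;>
      simp_all <;> first | omega | exact absurd (h₁ a) c | exact absurd (h₂ b) c

theorem agentsIn_set {D : Set ℕ} {pos : List ℕ} {a u v : ℕ} (h : pos[a]? = some u) :
    (u ∈ D → v ∈ D → agentsIn D (pos.set a v) = agentsIn D pos) ∧
    (u ∉ D → v ∉ D → agentsIn D (pos.set a v) = agentsIn D pos) ∧
    (u ∈ D → v ∉ D → agentsIn D (pos.set a v) + 1 = agentsIn D pos) ∧
    (u ∉ D → v ∈ D → agentsIn D (pos.set a v) = agentsIn D pos + 1) := by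
  classical
  induction pos generalizing a with
  | nil => simp at h
  | cons x pos ih =>
    cases a with
    | zero =>
      simp only [List.getElem?_cons_zero, Option.some.injEq] at h
      subst h
      simp only [agentsIn, List.set_cons_zero, List.countP_cons, decide_eq_true_eq]
      refine ⟨?_, ?_, ?_, ?_⟩ <;> intro h1 h2 <;> simp [h1, h2]
    | succ a =>
      have := ih (a := a) (by simpa using h)
      simp only [agentsIn, List.set_cons_succ, List.countP_cons] at this ⊢
      refine ⟨fun h1 h2 => ?_, fun h1 h2 => ?_, fun h1 h2 => ?_, fun h1 h2 => ?_⟩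
      · rw [this.1 h1 h2]
      · rw [this.2.1 h1 h2]
      · have := this.2.2.1 h1 h2; omega
      · have := this.2.2.2 h1 h2; omega

/-- If `e` is the only edge that leaves `D`, then the number of agents in `D` changes at most as
often as `e` is traversed. -/
theorem agentsIn_endPos {T : WTree} {D : Set ℕ} {e : Sym2 ℕ} (hhome : T.home ∉ D)
    (hcut : ∀ u v, T.tree.Adj u v → u ∈ D → v ∉ D → s(u, v) = e) {pos : List ℕ}
    {ms : List Move} (h : Legal T pos ms) :
    agentsIn D (endPos T.home pos ms) ≤ agentsIn D pos + crossings T.home e pos ms ∧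
    agentsIn D pos ≤ agentsIn D (endPos T.home pos ms) + crossings T.home e pos ms := by
  classical
  induction ms generalizing pos with
  | nil => simp [endPos, crossings]
  | cons m ms ih =>
    cases m with
    | invoke =>
      have := ih (pos := pos ++ [T.home]) h
      have h2 : agentsIn D (pos ++ [T.home]) = agentsIn D pos := by simp [agentsIn, hhome]
      rw [h2] at this
      exact this
    | traverse a v =>
      obtain ⟨⟨u, hu, hadj⟩, h⟩ := h
      have hi := ih (pos := pos.set a v) h
      have hs := agentsIn_set (D := D) (v := v) hu
      simp only [endPos, crossings, hu, Option.map_some, Option.some.injEq]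
      by_cases h1 : u ∈ D <;> by_cases h2 : v ∈ D
      · rw [hs.1 h1 h2] at hi; omega
      · have := hs.2.2.1 h1 h2
        rw [if_pos (hcut u v hadj h1 h2)]; omega
      · have := hs.2.2.2 h1 h2
        rw [if_pos (by rw [Sym2.eq_swap]; exact hcut v u hadj.symm h2 h1)]; omega
      · rw [hs.2.1 h1 h2] at hi; omega

/-- Distances dominate the weighted edge crossings of pairwise different edges. -/
theorem sum_crossings_le_totalDistance {T : WTree} (E : Finset (Sym2 ℕ))
    {pos : List ℕ} {ms : List Move} (h : Legal T pos ms) :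
    ∑ e ∈ E, T.weight e * crossings T.home e pos ms ≤ totalDistance T pos ms := by
  induction ms generalizing pos with
  | nil => simp [crossings, totalDistance]
  | cons m ms ih =>
    cases m with
    | invoke => exact ih h
    | traverse a v =>
      obtain ⟨⟨u, hu, hadj⟩, h⟩ := h
      have hi := ih (pos := pos.set a v) h
      simp only [totalDistance, crossings, hu, Option.map_some, Option.some.injEq]
      push_cast
      simp only [mul_add, Finset.sum_add_distrib]
      refine add_le_add ?_ hi
      simp only [mul_ite, mul_one, mul_zero]
      rw [Finset.sum_ite_eq]
      split_ifs
      · exact le_rfl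
      · exact (T.weight_pos _ hadj).le

/-! ### Runs of a decision rule -/

/-- The rule `next` performs the moves `ms` on `T`, and possibly more. -/
def IsRun (next : List Event → Option Move) (T : WTree) (ms : List Move) : Prop :=
  ∀ (i : ℕ) (hi : i < ms.length), next (history T (ms.take i)) = some ms[i]

theorem IsRun.nil (next : List Event → Option Move) (T : WTree) : IsRun next T [] := by
  intro i hi; simp at hi

theorem IsRun.concat {next : List Event → Option Move} {T : WTree} {ms : List Move} {m : Move}
    (h : IsRun next T ms) (hm : next (history T ms) = some m) : IsRun next T (ms ++ [m]) := by
  intro i hi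
  rcases Nat.lt_or_ge i ms.length with hlt | hge
  · rw [List.take_append_of_le_length hlt.le, List.getElem_append_left hlt]
    exact h i hlt
  · have : i = ms.length := by simp at hi; omega
    subst this
    simpa using hm

theorem IsRun.of_append {next : List Event → Option Move} {T : WTree} {m₁ m₂ : List Move}
    (h : IsRun next T (m₁ ++ m₂)) : IsRun next T m₁ := by
  intro i hi
  have := h i (by simp; omega)
  rwa [List.take_append_of_le_length hi.le, List.getElem_append_left hi] at this

theorem IsRun.next_eq {next : List Event → Option Move} {T : WTree} {m₁ m₂ : List Move} {m : Move}
    (h : IsRun next T (m₁ ++ m :: m₂)) : next (history T m₁) = some m := by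
  have := h m₁.length (by simp)
  simpa using this

/-- Every run is a prefix of the complete run. -/
theorem IsRun.prefix_of_performs {next : List Event → Option Move} {T : WTree}
    {ms L : List Move} (h : IsRun next T L) (hp : Performs next T ms) : L <+: ms := by
  induction L using List.reverseRecOn with
  | nil => exact List.nil_prefix
  | append_singleton L m ih =>
    obtain ⟨t, rfl⟩ := ih h.of_append
    have hm := h.next_eq (m₂ := [])
    cases t with
    | nil =>
      have := hp.2
      rw [List.append_nil, hm] at this
      cases this
    | cons m' t =>
      have := IsRun.next_eq (m₂ := t) hp.1
      rw [hm] at this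
      cases this
      exact ⟨t, by simp⟩

theorem Performs.unique {next : List Event → Option Move} {T : WTree} {m₁ m₂ : List Move}
    (h₁ : Performs next T m₁) (h₂ : Performs next T m₂) : m₁ = m₂ :=
  (IsRun.prefix_of_performs h₁.1 h₂).eq_of_length_le
    (IsRun.prefix_of_performs h₂.1 h₁).length_le

theorem OnlineStrategy.performs_moves (S : OnlineStrategy) (T : WTree) :
    Performs S.next T (S.moves T) := (S.explores T).choose_spec.1

theorem OnlineStrategy.explores_moves (S : OnlineStrategy) (T : WTree) :
    Explores T (S.moves T) := (S.explores T).choose_spec.2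

theorem OnlineStrategy.moves_eq {S : OnlineStrategy} {T : WTree} {ms : List Move}
    (h : Performs S.next T ms) : S.moves T = ms := (S.performs_moves T).unique h

/-! ### Lower bound on the optimum -/

/-- The vertices from which `v` is reached by iterating `par`. -/
def descendants (par : ℕ → ℕ) (v : ℕ) : Set ℕ := {x | ∃ k, par^[k] x = v}

/-! ### Cuts below a vertex, and the total weight as a lower bound. -/

namespace RootedBy

variable {T : WTree} {par rk : ℕ → ℕ}

theorem home_notMem_descendants (R : RootedBy T par rk) {v : ℕ} (hv : v ≠ T.home) :
    T.home ∉ descendants par v := by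
  rintro ⟨k, hk⟩
  rw [Function.iterate_fixed R.par_home] at hk
  exact hv hk.symm

/-- Every edge joins a child to its parent. Children of descendants are descendants, and only `v`
itself can have a parent that is not one. -/
theorem descendants_cut (R : RootedBy T par rk) {v : ℕ} (x y : ℕ)
    (h : T.tree.Adj x y) (hx : x ∈ descendants par v) (hy : y ∉ descendants par v) :
    s(x, y) = s(v, par v) := by
  obtain ⟨k, hk⟩ := hx
  obtain ⟨-, -, ⟨-, h⟩ | ⟨-, h⟩⟩ := (R.adj_iff x y).1 h
  · exact absurd ⟨k + 1, by rw [Function.iterate_succ_apply, h, hk]⟩ hy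
  · cases k with
    | zero => obtain rfl : x = v := hk; rw [h]
    | succ k => exact absurd ⟨k, by rw [← h, ← Function.iterate_succ_apply, hk]⟩ hy

theorem par_adj (R : RootedBy T par rk) {v : ℕ} (hv : v ∈ T.tree.verts) (hne : v ≠ T.home) :
    T.tree.Adj (par v) v :=
  (R.adj_iff _ _).2 ⟨R.par_mem v hv, hv, Or.inl ⟨hne, rfl⟩⟩

theorem par_ne (R : RootedBy T par rk) {v : ℕ} (hv : v ∈ T.tree.verts) (hne : v ≠ T.home) :
    par v ≠ v := fun h => by
  have := R.rk_lt v hv hne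
  rw [h] at this
  exact this.false

/-- The edges to the parents are pairwise different. -/
theorem edge_injOn (R : RootedBy T par rk) :
    Set.InjOn (fun v => s(v, par v)) {v | v ∈ T.tree.verts ∧ v ≠ T.home} := by
  rintro v ⟨hv, hv'⟩ w ⟨hw, hw'⟩ h
  rcases Sym2.eq_iff.1 h with ⟨h, -⟩ | ⟨h₁, h₂⟩
  · exact h
  · have h3 := R.rk_lt v hv hv'
    have h4 := R.rk_lt w hw hw'
    rw [h₂] at h3
    rw [← h₁] at h4
    omega

/-- The total weight of all edges. -/
noncomputable def totalWeight (_ : RootedBy T par rk) : ℝ :=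
  ∑ v ∈ T.finite.toFinset.erase T.home, T.weight s(v, par v)

/-- When `v` is visited, an agent is among its descendants. Initially none is, and the count changes
only by crossings of the edge above `v`. -/
theorem crossings_pos (R : RootedBy T par rk) {v : ℕ} (hv : v ∈ T.tree.verts) (hne : v ≠ T.home)
    {ms : List Move} (h : Explores T ms) : 1 ≤ crossings T.home s(v, par v) [] ms := by
  obtain ⟨m₁, m₂, rfl, hm⟩ := exists_split_of_reached h.1 (h.2 v hv)
  have h1 := (agentsIn_endPos (R.home_notMem_descendants hne) (R.descendants_cut (v := v))
    ((legal_append _ _ _ _).1 h.1).1).1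
  have h2 : 0 < agentsIn (descendants par v) (endPos T.home [] m₁) :=
    agentsIn_pos_iff.2 ⟨v, hm, 0, rfl⟩
  rw [agentsIn_nil] at h1
  rw [crossings_append]
  omega

theorem sum_le_totalDistance (R : RootedBy T par rk) {ι : Type*} (s : Finset ι) (f : ι → ℕ)
    (hinj : Set.InjOn f s) (hf : ∀ i ∈ s, f i ∈ T.tree.verts ∧ f i ≠ T.home)
    {pos : List ℕ} {ms : List Move} (h : Legal T pos ms) :
    ∑ i ∈ s, T.weight s(f i, par (f i)) * crossings T.home s(f i, par (f i)) pos ms ≤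
      totalDistance T pos ms := by
  classical
  have := sum_crossings_le_totalDistance (s.image fun i => s(f i, par (f i))) h
  rwa [Finset.sum_image] at this
  intro i hi j hj hij
  exact hinj hi hj (R.edge_injOn (hf i hi) (hf j hj) hij)

theorem totalWeight_le_totalDistance (R : RootedBy T par rk) {ms : List Move}
    (h : Explores T ms) : R.totalWeight ≤ totalDistance T [] ms := by
  have hmem : ∀ v ∈ T.finite.toFinset.erase T.home, v ∈ T.tree.verts ∧ v ≠ T.home := by
    intro v hv
    rw [Finset.mem_erase, Set.Finite.mem_toFinset] at hv
    exact hv.symm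
  refine le_trans (Finset.sum_le_sum fun v hv => ?_)
    (R.sum_le_totalDistance _ id Function.injective_id.injOn hmem h.1)
  obtain ⟨hv, hne⟩ := hmem v hv
  have h1 : (1 : ℝ) ≤ crossings T.home s(v, par v) [] ms := by
    exact_mod_cast R.crossings_pos hv hne h
  exact le_mul_of_one_le_right (T.weight_pos _ (R.par_adj hv hne).symm).le h1

end RootedBy

theorem numAgents_pos {T : WTree} {ms : List Move} (h : Explores T ms) : 1 ≤ numAgents ms := by
  obtain ⟨hl, hv⟩ := h
  cases ms with
  | nil => obtain ⟨m, hm, -⟩ := hv _ T.home_mem; simp at hm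
  | cons m ms =>
    cases m with
    | invoke => simp [numAgents]
    | traverse a v => obtain ⟨⟨u, hu, -⟩, -⟩ := hl; simp at hu

theorem cost_nonneg {q : ℝ} (hq : 0 ≤ q) {T : WTree} {ms : List Move} (h : Explores T ms) :
    0 ≤ cost q T ms :=
  add_nonneg (by positivity) (totalDistance_nonneg h.1)

theorem optCost_le {q : ℝ} (hq : 0 ≤ q) {T : WTree} {ms : List Move} (h : Explores T ms) :
    optCost q T ≤ cost q T ms :=
  csInf_le ⟨0, by rintro c ⟨ms, h, rfl⟩; exact cost_nonneg hq h⟩ ⟨ms, h, rfl⟩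

theorem RootedBy.le_optCost {q : ℝ} (hq : 0 ≤ q) {T : WTree} {par rk : ℕ → ℕ}
    (R : RootedBy T par rk) (hT : ∃ ms, Explores T ms) : q + R.totalWeight ≤ optCost q T := by
  obtain ⟨ms, hms⟩ := hT
  -- An exploring strategy is needed here: the real infimum of the empty set is 0 by convention.
  refine le_csInf ⟨_, ms, hms, rfl⟩ ?_
  rintro c ⟨ms, h, rfl⟩
  refine add_le_add ?_ (R.totalWeight_le_totalDistance h)
  have : (1 : ℝ) ≤ numAgents ms := by exact_mod_cast numAgents_pos h
  exact le_mul_of_one_le_left hq this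

/-! ### Depth-first search without return -/

theorem visited_history {T : WTree} {ms : List Move} {x : ℕ} :
    Visited (history T ms) x ↔ ∃ m ∈ ms, reached T m = x := by
  simp [Visited, history, observe]

/-- If one prefix were longer, it would contain the visit to `c` that follows the other. So the
first visit is well located, and depth-first parents are unique. -/
theorem eq_of_append_cons_eq {h a a' b b' : List Event} {e e' : Event} {c : ℕ}
    (h₁ : h = a ++ e :: b) (h₂ : h = a' ++ e' :: b') (he : e.vertex = c) (he' : e'.vertex = c)
    (ha : ¬ Visited a c) (ha' : ¬ Visited a' c) : a = a' := by
  subst h₁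
  rcases List.append_eq_append_iff.1 h₂ with ⟨t, rfl, ht⟩ | ⟨t, rfl, ht⟩
  · cases t with
    | nil => simp
    | cons f t =>
      obtain ⟨rfl, -⟩ := List.cons_eq_cons.1 ht
      exact absurd ⟨e, by simp, he⟩ ha'
  · cases t with
    | nil => simp
    | cons f t =>
      obtain ⟨rfl, -⟩ := List.cons_eq_cons.1 ht
      exact absurd ⟨e', by simp, he'⟩ ha

theorem IsDFSParent.unique {h : List Event} {c p p' : ℕ} (hp : IsDFSParent h c p)
    (hp' : IsDFSParent h c p') : p = p' := by
  obtain ⟨h₁, h₂, e₁, e₂, hh, rfl, he, hv⟩ := hp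
  obtain ⟨h₁', h₂', e₁', e₂', hh', rfl, he', hv'⟩ := hp'
  have := eq_of_append_cons_eq (a := h₁ ++ [e₁]) (a' := h₁' ++ [e₁']) (b := h₂) (b' := h₂')
    (e := e₂) (e' := e₂') (by simpa using hh) (by simpa using hh') he he' hv hv'
  rw [(List.append_singleton_inj.1 this).2]

theorem IsDFSParent.append {h : List Event} {c p : ℕ} (hp : IsDFSParent h c p) (h' : List Event) :
    IsDFSParent (h ++ h') c p := by
  obtain ⟨h₁, h₂, e₁, e₂, rfl, h⟩ := hp
  exact ⟨h₁, h₂ ++ h', e₁, e₂, by simp, h⟩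

/-- The three clauses have mutually exclusive premises and the parent is unique, so a suitable move
can be chosen for each history separately, including histories that no tree produces. -/
theorem exists_isDFSWithoutReturn : ∃ next, IsDFSWithoutReturn next := by
  classical
  have key : ∀ h : List Event, ∃ m : Option Move, (h = [] → m = some Move.invoke) ∧
      ∀ h' e, h = h' ++ [e] →
      ((∃ p ∈ e.star, ¬ Visited h p.1) →
        ∃ p ∈ e.star, ¬ Visited h p.1 ∧ m = some (Move.traverse 0 p.1)) ∧
      ((∀ p ∈ e.star, Visited h p.1) → (∃ f ∈ h', ∃ p ∈ f.star, ¬ Visited h p.1) →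
        ∀ u, IsDFSParent h e.vertex u → m = some (Move.traverse 0 u)) ∧
      ((∀ f ∈ h, ∀ p ∈ f.star, Visited h p.1) → m = none) := by
    intro h
    rcases List.eq_nil_or_concat' h with rfl | ⟨h', e, rfl⟩
    · exact ⟨some Move.invoke, fun _ => rfl, fun h' e h => by simp at h⟩
    suffices H : ∃ m : Option Move,
        ((∃ p ∈ e.star, ¬ Visited (h' ++ [e]) p.1) →
          ∃ p ∈ e.star, ¬ Visited (h' ++ [e]) p.1 ∧ m = some (Move.traverse 0 p.1)) ∧
        ((∀ p ∈ e.star, Visited (h' ++ [e]) p.1) →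
          (∃ f ∈ h', ∃ p ∈ f.star, ¬ Visited (h' ++ [e]) p.1) →
          ∀ u, IsDFSParent (h' ++ [e]) e.vertex u → m = some (Move.traverse 0 u)) ∧
        ((∀ f ∈ h' ++ [e], ∀ p ∈ f.star, Visited (h' ++ [e]) p.1) → m = none) by
      obtain ⟨m, hm⟩ := H
      refine ⟨m, by simp, ?_⟩
      intro h'' e' hh
      obtain ⟨rfl, rfl⟩ := List.append_singleton_inj.1 hh
      exact hm
    by_cases h1 : ∃ p ∈ e.star, ¬ Visited (h' ++ [e]) p.1
    · obtain ⟨p, hp, hv⟩ := h1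
      exact ⟨some (Move.traverse 0 p.1), fun _ => ⟨p, hp, hv, rfl⟩,
        fun h => absurd (h p hp) hv, fun h => absurd (h e (by simp) p hp) hv⟩
    by_cases h2 : ∀ f ∈ h' ++ [e], ∀ p ∈ f.star, Visited (h' ++ [e]) p.1
    · refine ⟨none, fun h => absurd h h1, ?_, fun _ => rfl⟩
      rintro - ⟨f, hf, p, hp, hv⟩
      exact absurd (h2 f (by simp [hf]) p hp) hv
    by_cases h3 : ∃ u, IsDFSParent (h' ++ [e]) e.vertex u
    · obtain ⟨u, hu⟩ := h3
      exact ⟨some (Move.traverse 0 u), fun h => absurd h h1,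
        fun _ _ u' hu' => by rw [hu.unique hu'], fun h => absurd h h2⟩
    -- Without a parent the second clause is vacuous, so stopping is a harmless default.
    · exact ⟨none, fun h => absurd h h1, fun _ _ u hu => absurd ⟨u, hu⟩ h3, fun _ => rfl⟩
  choose next h0 hn using key
  exact ⟨next, h0 [] rfl, fun h e => hn (h ++ [e]) h e rfl⟩

/-- A state of depth-first search after the moves `ms`: the agent is at `c`, the vertices `V` have
been visited, and the agent has gone back to the parent from each vertex in `F`. -/
structure DFSState (next : List Event → Option Move) (T : WTree) (par : ℕ → ℕ)
    (ms : List Move) (c : ℕ) (V F : Finset ℕ) : Prop where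
  run : IsRun next T ms
  legal : Legal T [] ms
  endPos_eq : endPos T.home [] ms = [c]
  last : ∃ ms' m, ms = ms' ++ [m] ∧ reached T m = c
  agents : numAgents ms = 1
  mem_V : ∀ x, x ∈ V ↔ ∃ m ∈ ms, reached T m = x
  V_sub : ∀ x ∈ V, x ∈ T.tree.verts
  home_mem : T.home ∈ V
  par_mem : ∀ x ∈ V, par x ∈ V
  parent : ∀ x ∈ V, x ≠ T.home → IsDFSParent (history T ms) x (par x)
  F_sub : F ⊆ V
  home_notMem : T.home ∉ F
  notMem_F : c ∉ F
  mem_F : ∀ x ∈ F, ∀ y ∈ T.tree.verts, y ≠ T.home → par y = x → y ∈ F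
  anc : ∀ x ∈ V, x ∉ F → c ∈ descendants par x
  dist : totalDistance T [] ms =
    ∑ v ∈ V.erase T.home, T.weight s(v, par v) + ∑ v ∈ F, T.weight s(v, par v)

/-! ### The invariant of depth-first search and its preservation. -/

namespace DFSState

variable {next : List Event → Option Move} {T : WTree} {par rk : ℕ → ℕ} {ms : List Move} {c : ℕ}
  {V F : Finset ℕ}

theorem init (hn : IsDFSWithoutReturn next) (R : RootedBy T par rk) :
    DFSState next T par [Move.invoke] T.home {T.home} ∅ where
  run := IsRun.concat (IsRun.nil _ _) hn.1
  legal := trivial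
  endPos_eq := rfl
  last := ⟨[], Move.invoke, rfl, rfl⟩
  agents := rfl
  mem_V := fun x => by simp [reached, eq_comm]
  V_sub := fun x hx => by rw [Finset.mem_singleton.1 hx]; exact T.home_mem
  home_mem := by simp
  par_mem := fun x hx => by rw [Finset.mem_singleton.1 hx, R.par_home]; simp
  parent := fun x hx hne => absurd (Finset.mem_singleton.1 hx) hne
  F_sub := by simp
  home_notMem := by simp
  notMem_F := by simp
  mem_F := by simp
  anc := fun x hx _ => by rw [Finset.mem_singleton.1 hx]; exact ⟨0, rfl⟩
  dist := by simp [totalDistance]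

theorem mem_V' (h : DFSState next T par ms c V F) {x : ℕ} :
    Visited (history T ms) x ↔ x ∈ V := by rw [visited_history, h.mem_V]

theorem c_mem (h : DFSState next T par ms c V F) : c ∈ V := by
  obtain ⟨ms', m, rfl, hm⟩ := h.last
  exact (h.mem_V c).2 ⟨m, by simp, hm⟩

theorem totalDistance_concat (h : DFSState next T par ms c V F) (v : ℕ) :
    totalDistance T [] (ms ++ [Move.traverse 0 v]) = totalDistance T [] ms + T.weight s(c, v) := by
  simp [totalDistance_append, h.endPos_eq, totalDistance]

/-- The visited set is closed under parents, so an unvisited neighbour of `c` is a child of `c`. Its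
edge enters the first sum of `dist`. -/
theorem down (h : DFSState next T par ms c V F) (R : RootedBy T par rk) {v : ℕ}
    (hadj : T.tree.Adj c v) (hv : v ∉ V)
    (hnext : next (history T ms) = some (Move.traverse 0 v)) :
    DFSState next T par (ms ++ [Move.traverse 0 v]) v (insert v V) F := by
  obtain ⟨-, hvT, ⟨hne, hpar⟩ | ⟨-, hpar⟩⟩ := (R.adj_iff c v).1 hadj
  swap
  · exact absurd (hpar ▸ h.par_mem c h.c_mem) hv
  refine ⟨h.run.concat hnext, ?_, ?_, ⟨_, _, rfl, rfl⟩, ?_, ?_, ?_, ?_, ?_, ?_, ?_, h.home_notMem,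
    ?_, h.mem_F, ?_, ?_⟩
  · rw [legal_append]
    refine ⟨h.legal, ?_⟩
    rw [h.endPos_eq]
    exact ⟨⟨c, rfl, hadj⟩, trivial⟩
  · rw [endPos_append, h.endPos_eq]; rfl
  · rw [numAgents_append, h.agents]; rfl
  · intro x
    rw [Finset.mem_insert, h.mem_V]
    simp [or_and_right, exists_or, reached, or_comm, eq_comm]
  · intro x hx
    rcases Finset.mem_insert.1 hx with rfl | hx
    · exact hvT
    · exact h.V_sub x hx
  · exact Finset.mem_insert_of_mem h.home_mem
  · intro x hx
    rcases Finset.mem_insert.1 hx with rfl | hx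
    · rw [hpar]; exact Finset.mem_insert_of_mem h.c_mem
    · exact Finset.mem_insert_of_mem (h.par_mem x hx)
  · intro x hx hxne
    rcases Finset.mem_insert.1 hx with rfl | hx
    · obtain ⟨ms', m, hms, hm⟩ := h.last
      refine ⟨history T ms', [], observe T m, observe T (Move.traverse 0 x), ?_, ?_, rfl, ?_⟩
      · rw [hms]; simp [history]
      · rw [hpar]; exact hm
      · have : history T ms' ++ [observe T m] = history T ms := by rw [hms]; simp [history]
        rwa [this, h.mem_V']
    · have := (h.parent x hx hxne).append [observe T (Move.traverse 0 v)]
      simpa [history] using this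
  · exact h.F_sub.trans (Finset.subset_insert _ _)
  · exact fun hF => hv (h.F_sub hF)
  · intro x hx hxF
    rcases Finset.mem_insert.1 hx with rfl | hx
    · exact ⟨0, rfl⟩
    · obtain ⟨k, hk⟩ := h.anc x hx hxF
      exact ⟨k + 1, by rw [Function.iterate_succ_apply, hpar, hk]⟩
  · rw [h.totalDistance_concat, h.dist, Finset.erase_insert_of_ne hne,
      Finset.sum_insert (fun hh => hv (Finset.mem_of_mem_erase hh)), hpar, Sym2.eq_swap]
    ring

theorem rk_iterate_le (R : RootedBy T par rk) {x : ℕ} (hx : x ∈ T.tree.verts) (k : ℕ) :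
    rk (par^[k] x) ≤ rk x := by
  induction k generalizing x with
  | zero => exact le_rfl
  | succ k ih =>
    rw [Function.iterate_succ_apply]
    refine (ih (R.par_mem x hx)).trans ?_
    by_cases hne : x = T.home
    · rw [hne, R.par_home]
    · exact (R.rk_lt x hx hne).le

/-- The edge above `c` enters the second sum of `dist`. Since `c ∉ F`, no edge is charged twice
there. -/
theorem up (h : DFSState next T par ms c V F) (R : RootedBy T par rk) (hne : c ≠ T.home)
    (hstar : ∀ v, T.tree.Adj c v → v ∈ V)
    (hnext : next (history T ms) = some (Move.traverse 0 (par c))) :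
    DFSState next T par (ms ++ [Move.traverse 0 (par c)]) (par c) V (insert c F) := by
  have hcT := h.V_sub c h.c_mem
  have hadj := (R.par_adj hcT hne).symm
  refine ⟨h.run.concat hnext, ?_, ?_, ⟨_, _, rfl, rfl⟩, ?_, ?_, h.V_sub, h.home_mem, h.par_mem, ?_,
    ?_, ?_, ?_, ?_, ?_, ?_⟩
  · rw [legal_append]
    refine ⟨h.legal, ?_⟩
    rw [h.endPos_eq]
    exact ⟨⟨c, rfl, hadj⟩, trivial⟩
  · rw [endPos_append, h.endPos_eq]; rfl
  · rw [numAgents_append, h.agents]; rfl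
  · intro x
    constructor
    · intro hx
      obtain ⟨m, hm, hmx⟩ := (h.mem_V x).1 hx
      exact ⟨m, List.mem_append_left _ hm, hmx⟩
    · rintro ⟨m, hm, hmx⟩
      rcases List.mem_append.1 hm with hm | hm
      · exact (h.mem_V x).2 ⟨m, hm, hmx⟩
      · rw [List.mem_singleton.1 hm] at hmx
        rw [← hmx]
        exact h.par_mem c h.c_mem
  · intro x hx hxne
    have := (h.parent x hx hxne).append [observe T (Move.traverse 0 (par c))]
    simpa [history] using this
  · exact Finset.insert_subset h.c_mem h.F_sub
  · rw [Finset.mem_insert, not_or]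
    exact ⟨hne.symm, h.home_notMem⟩
  -- `F` contains all children of its members, so `par c ∈ F` would force `c ∈ F`.
  · rw [Finset.mem_insert, not_or]
    exact ⟨R.par_ne hcT hne, fun hF => h.notMem_F (h.mem_F _ hF c hcT hne rfl)⟩
  · intro x hx y hy hyne hpar
    rcases Finset.mem_insert.1 hx with rfl | hx
    -- A visited child of `c` outside `F` would be an ancestor of `c`, against the ranks.
    · refine Finset.mem_insert_of_mem (by_contra fun hyF => ?_)
      obtain ⟨k, hk⟩ := h.anc y (hstar y ((R.adj_iff _ _).2 ⟨hcT, hy, Or.inl ⟨hyne, hpar⟩⟩)) hyF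
      have h1 := rk_iterate_le R hcT k
      have h2 := R.rk_lt y hy hyne
      rw [hk] at h1
      rw [hpar] at h2
      omega
    · exact Finset.mem_insert_of_mem (h.mem_F x hx y hy hyne hpar)
  · intro x hx hxF
    rw [Finset.mem_insert, not_or] at hxF
    obtain ⟨k, hk⟩ := h.anc x hx hxF.2
    cases k with
    | zero => exact absurd hk.symm hxF.1
    | succ k => exact ⟨k, by rw [← Function.iterate_succ_apply, hk]⟩
  · rw [h.totalDistance_concat, h.dist, Finset.sum_insert h.notMem_F]
    ring

theorem cost_le (h : DFSState next T par ms c V F) (R : RootedBy T par rk) (q : ℝ) :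
    cost q T ms ≤ q + 2 * R.totalWeight := by
  have hw : ∀ v ∈ T.finite.toFinset.erase T.home, 0 ≤ T.weight s(v, par v) := by
    intro v hv
    rw [Finset.mem_erase, Set.Finite.mem_toFinset] at hv
    exact (T.weight_pos _ (R.par_adj hv.2 hv.1).symm).le
  have h1 : ∑ v ∈ V.erase T.home, T.weight s(v, par v) ≤ R.totalWeight := by
    refine Finset.sum_le_sum_of_subset_of_nonneg (Finset.erase_subset_erase _ fun x hx => ?_)
      fun v hv _ => hw v hv
    exact T.finite.mem_toFinset.2 (h.V_sub x hx)
  have h2 : ∑ v ∈ F, T.weight s(v, par v) ≤ R.totalWeight := by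
    refine Finset.sum_le_sum_of_subset_of_nonneg (fun x hx => ?_) fun v hv _ => hw v hv
    exact Finset.mem_erase.2 ⟨fun hh => h.home_notMem (hh ▸ hx),
      T.finite.mem_toFinset.2 (h.V_sub x (h.F_sub hx))⟩
  rw [cost, h.agents, h.dist]
  push_cast
  linarith

/-- Depth-first search either makes a further move or has explored the tree and stops. -/
theorem step (h : DFSState next T par ms c V F) (hn : IsDFSWithoutReturn next)
    (R : RootedBy T par rk) :
    (∃ ms' c' V' F', DFSState next T par ms' c' V' F' ∧ V'.card + F'.card = V.card + F.card + 1) ∨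
    (Performs next T ms ∧ Explores T ms) := by
  obtain ⟨ms', m, hms, hm⟩ := h.last
  have hh : history T ms = history T ms' ++ [observe T m] := by rw [hms]; simp [history]
  obtain ⟨h1, h2, h3⟩ := hn.2 (history T ms') (observe T m)
  rw [← hh] at h1 h2 h3
  have hstar : ∀ p ∈ (observe T m).star, T.tree.Adj c p.1 := fun p hp => hm ▸ hp.1
  have hstar' : ∀ v, T.tree.Adj c v → ∃ p ∈ (observe T m).star, p.1 = v :=
    fun v hv => ⟨(v, T.weight s(reached T m, v)), ⟨hm.symm ▸ hv, rfl⟩, rfl⟩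
  by_cases hc1 : ∃ p ∈ (observe T m).star, ¬ Visited (history T ms) p.1
  · obtain ⟨p, hp, hv, hnext⟩ := h1 hc1
    rw [h.mem_V'] at hv
    exact Or.inl ⟨_, _, _, _, h.down R (hstar p hp) hv hnext, by
      rw [Finset.card_insert_of_notMem hv]; omega⟩
  push Not at hc1
  have hcV : ∀ v, T.tree.Adj c v → v ∈ V := by
    intro v hv
    obtain ⟨p, hp, rfl⟩ := hstar' v hv
    exact h.mem_V'.1 (hc1 p hp)
  by_cases hc3 : ∀ f ∈ history T ms, ∀ p ∈ f.star, Visited (history T ms) p.1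
  · refine Or.inr ⟨⟨h.run, h3 hc3⟩, h.legal, ?_⟩
    have hclosed : ∀ x ∈ V, ∀ y, T.tree.Adj x y → y ∈ V := by
      intro x hx y hxy
      obtain ⟨m', hm', rfl⟩ := (h.mem_V x).1 hx
      exact h.mem_V'.1 (hc3 (observe T m') (List.mem_map_of_mem hm') 
        (y, T.weight s(reached T m', y)) ⟨hxy, rfl⟩)
    -- The visited set is closed under adjacency and contains the homebase; induction on the rank
    -- gives all vertices.
    have hall : ∀ n, ∀ v ∈ T.tree.verts, rk v ≤ n → v ∈ V := by
      intro n
      induction n with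
      | zero =>
        intro v hv hr
        by_cases hne : v = T.home
        · exact hne ▸ h.home_mem
        · have := R.rk_lt v hv hne; omega
      | succ n ih =>
        intro v hv hr
        by_cases hne : v = T.home
        · exact hne ▸ h.home_mem
        · have := R.rk_lt v hv hne
          exact hclosed _ (ih _ (R.par_mem v hv) (by omega)) v (R.par_adj hv hne)
    exact fun x hx => (h.mem_V x).1 (hall _ x hx le_rfl)
  · push Not at hc3
    obtain ⟨f, hf, p, hp, hv⟩ := hc3
    have hf' : f ∈ history T ms' := by
      rw [hh, List.mem_append, List.mem_singleton] at hf
      rcases hf with hf | rfl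
      · exact hf
      · exact absurd (hc1 p hp) hv
    obtain ⟨m', hm', rfl⟩ := List.mem_map.1 hf
    rw [h.mem_V'] at hv
    have hx : reached T m' ∈ V := (h.mem_V _).2 ⟨m', hm', rfl⟩
    have hadj : T.tree.Adj (reached T m') p.1 := hp.1
    -- At the homebase no known vertex can be unvisited: visited vertices other than `c` would all
    -- lie in `F`, so their children are visited, and so are the neighbours of `c`.
    have hne : c ≠ T.home := by
      intro hce
      obtain ⟨-, hpT, ⟨hpne, hpar⟩ | ⟨-, hpar⟩⟩ := (R.adj_iff _ _).1 hadj
      · by_cases hxF : reached T m' ∈ F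
        · exact hv (h.F_sub (h.mem_F _ hxF _ hpT hpne hpar))
        · obtain ⟨k, hk⟩ := h.anc _ hx hxF
          rw [hce, Function.iterate_fixed R.par_home, ← hce] at hk
          exact hv (hcV _ (hk ▸ hadj))
      · exact hv (hpar ▸ h.par_mem _ hx)
    have hnext := h2 hc1 ⟨_, hf', p, hp, by rwa [h.mem_V']⟩ (par c)
      (by change IsDFSParent _ (reached T m) _; rw [hm]; exact h.parent c h.c_mem hne)
    exact Or.inl ⟨_, _, _, _, h.up R hne hcV hnext, by
      rw [Finset.card_insert_of_notMem h.notMem_F]; omega⟩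

/-- `V.card + F.card` grows by one with each move and never exceeds twice the number of vertices;
`n` bounds the moves that remain. -/
theorem exists_complete (hn : IsDFSWithoutReturn next) (R : RootedBy T par rk) (n : ℕ)
    (h : DFSState next T par ms c V F) (hcard : 2 * T.finite.toFinset.card ≤ V.card + F.card + n) :
    ∃ ms c V F, DFSState next T par ms c V F ∧ Performs next T ms ∧ Explores T ms := by
  induction n generalizing ms c V F with
  | zero =>
    rcases h.step hn R with ⟨ms', c', V', F', h', hc⟩ | hd
    · have h1 : V'.card ≤ T.finite.toFinset.card :=
        Finset.card_le_card fun x hx => T.finite.mem_toFinset.2 (h'.V_sub x hx)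
      have h2 := Finset.card_le_card h'.F_sub
      omega
    · exact ⟨ms, c, V, F, h, hd⟩
  | succ n ih =>
    rcases h.step hn R with ⟨ms', c', V', F', h', hc⟩ | hd
    · exact ih h' (by omega)
    · exact ⟨ms, c, V, F, h, hd⟩

end DFSState

theorem IsDFSWithoutReturn.exists_performs {next : List Event → Option Move}
    (hn : IsDFSWithoutReturn next) {T : WTree} {par rk : ℕ → ℕ} (R : RootedBy T par rk) (q : ℝ) :
    ∃ ms, Performs next T ms ∧ Explores T ms ∧ cost q T ms ≤ q + 2 * R.totalWeight := by
  obtain ⟨ms, c, V, F, h, hp, he⟩ := DFSState.exists_complete hn R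
    (2 * T.finite.toFinset.card) (DFSState.init hn R) (by omega)
  exact ⟨ms, hp, he, h.cost_le R q⟩

/-- Depth-first search is itself an off-line strategy, so the infimum in `optCost` is over a
nonempty set. -/
theorem exists_explores (T : WTree) : ∃ ms, Explores T ms := by
  obtain ⟨next, hn⟩ := exists_isDFSWithoutReturn
  obtain ⟨par, rk, R⟩ := T.exists_rootedBy
  obtain ⟨ms, -, h, -⟩ := hn.exists_performs R 0
  exact ⟨ms, h⟩

theorem IsDFSWithoutReturn.exists_onlineStrategy {q : ℝ} (hq : 0 ≤ q)
    {next : List Event → Option Move} (hn : IsDFSWithoutReturn next) :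
    ∃ S : OnlineStrategy, S.next = next ∧ competitiveRatio q S ≤ 2 := by
  have hex : ∀ T : WTree, ∃ ms, Performs next T ms ∧ Explores T ms := by
    intro T
    obtain ⟨par, rk, R⟩ := T.exists_rootedBy
    obtain ⟨ms, h1, h2, -⟩ := hn.exists_performs R 0
    exact ⟨ms, h1, h2⟩
  refine ⟨⟨next, hex⟩, rfl, iSup_le fun T => ENNReal.div_le_of_le_mul ?_⟩
  obtain ⟨par, rk, R⟩ := T.exists_rootedBy
  obtain ⟨ms, h1, h2, h3⟩ := hn.exists_performs R q
  have h4 := R.le_optCost hq ⟨ms, h2⟩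
  have h5 : (2 : ℝ≥0∞) = ENNReal.ofReal 2 := by simp
  rw [OnlineStrategy.costOn, OnlineStrategy.moves_eq (S := ⟨next, hex⟩) h1, h5,
    ← ENNReal.ofReal_mul zero_le_two]
  exact ENNReal.ofReal_le_ofReal (by linarith)

/-! ### Trees that branch at the ends of the spine segments -/

/-- An enumeration of the triples of a stage, a branch and a depth. -/
def branchEquiv : ℕ × Bool × ℕ ≃ ℕ :=
  (Equiv.prodCongr (Equiv.refl ℕ) Equiv.boolProdNatEquivNat).trans Nat.pairEquiv

/-- A name for the vertex at distance `d` from the branching vertex in branch `b` of stage `i`. -/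
def branchVertex (i : ℕ) (b : Bool) (d : ℕ) : ℕ := branchEquiv (i, b, d)

theorem branchVertex_inj {i i' : ℕ} {b b' : Bool} {d d' : ℕ} :
    branchVertex i b d = branchVertex i' b' d' ↔ i = i' ∧ b = b' ∧ d = d' := by
  simp [branchVertex]

theorem exists_eq_branchVertex (x : ℕ) : ∃ i b d, x = branchVertex i b d := by
  obtain ⟨⟨i, b, d⟩, rfl⟩ := branchEquiv.surjective x
  exact ⟨i, b, d, rfl⟩

/-- For each stage `i`, the branch that continues the spine and the length of the other branch.
The stage `0` consists of the first spine segment only. -/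
structure BranchData (l : ℕ) where
  side : ℕ → Bool
  len : ℕ → ℕ
  len_le : ∀ i, len i ≤ l
  len_zero : len 0 = 0
  len_pos : ∀ i, 1 ≤ i → 1 ≤ len i

namespace BranchData

variable {l : ℕ} (p : BranchData l) (n : ℕ)

/-- The length of branch `b` in stage `i`. -/
def branchLen (i : ℕ) (b : Bool) : ℕ := if b = p.side i then l else p.len i

theorem branchLen_le (i : ℕ) (b : Bool) : p.branchLen i b ≤ l := by
  have := p.len_le i
  unfold branchLen
  split_ifs <;> omega

/-- The vertices of the first `n + 1` stages. -/
def IsVertex (t : ℕ × Bool × ℕ) : Prop :=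
  t = (0, false, 0) ∨ (t.1 ≤ n ∧ 1 ≤ t.2.2 ∧ t.2.2 ≤ p.branchLen t.1 t.2.1)

/-- The parent function. -/
def parent (t : ℕ × Bool × ℕ) : ℕ × Bool × ℕ :=
  if 2 ≤ t.2.2 then (t.1, t.2.1, t.2.2 - 1)
  else if t.2.2 = 0 ∨ t.1 = 0 then (0, false, 0)
  else (t.1 - 1, p.side (t.1 - 1), l)

/-- The set of names of the vertices. -/
def verts : Set ℕ := {x | p.IsVertex n (branchEquiv.symm x)}

/-- The parent function on names. -/
def par (x : ℕ) : ℕ :=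
  branchEquiv (p.parent (branchEquiv.symm x))

/-- A rank that decreases along the parent function. -/
def rk (_ : BranchData l) (x : ℕ) : ℕ :=
  (branchEquiv.symm x).1 * (l + 1) +
    (branchEquiv.symm x).2.2

theorem branchVertex_mem_verts {i : ℕ} {b : Bool} {d : ℕ} :
    branchVertex i b d ∈ p.verts n ↔
      (i = 0 ∧ b = false ∧ d = 0) ∨ (i ≤ n ∧ 1 ≤ d ∧ d ≤ p.branchLen i b) := by
  simp [verts, branchVertex, IsVertex]

theorem par_branchVertex (i : ℕ) (b : Bool) (d : ℕ) :
    p.par (branchVertex i b d) =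
      if 2 ≤ d then branchVertex i b (d - 1)
      else if d = 0 ∨ i = 0 then branchVertex 0 false 0
      else branchVertex (i - 1) (p.side (i - 1)) l := by
  simp only [par, branchVertex, parent, Equiv.symm_apply_apply]
  split_ifs <;> rfl

theorem rk_branchVertex (i : ℕ) (b : Bool) (d : ℕ) :
    p.rk (branchVertex i b d) = i * (l + 1) + d := by
  simp [rk, branchVertex]

theorem finite_verts : (p.verts n).Finite := by
  have h : ((Finset.range (n + 1) ×ˢ (Finset.univ : Finset Bool) ×ˢ Finset.range (l + 1) :
      Finset (ℕ × Bool × ℕ)) : Set (ℕ × Bool × ℕ)).Finite := Finset.finite_toSet _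
  refine (h.image branchEquiv).subset fun x hx => ?_
  refine ⟨branchEquiv.symm x, ?_, by simp⟩
  have h2 := p.branchLen_le (branchEquiv.symm x).1
    (branchEquiv.symm x).2.1
  rcases hx with hx | ⟨h1, h3, h4⟩
  · rw [hx]; simp
  · simp only [Finset.coe_product, Set.mem_prod, Finset.mem_coe, Finset.mem_range,
      Finset.mem_univ, true_and]
    omega

theorem home_mem_verts : branchVertex 0 false 0 ∈ p.verts n := by
  simp [branchVertex_mem_verts]

theorem par_mem_verts (hl : 1 ≤ l) : ∀ v ∈ p.verts n, p.par v ∈ p.verts n := by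
  intro v hv
  obtain ⟨i, b, d, rfl⟩ := exists_eq_branchVertex v
  rw [branchVertex_mem_verts] at hv
  rw [par_branchVertex]
  split_ifs with h1 h2
  · rw [branchVertex_mem_verts]; omega
  · exact p.home_mem_verts n
  · rw [branchVertex_mem_verts]
    refine Or.inr ⟨by omega, hl, by simp [branchLen]⟩

theorem rk_par_lt : ∀ v ∈ p.verts n, v ≠ branchVertex 0 false 0 → p.rk (p.par v) < p.rk v := by
  intro v hv hne
  obtain ⟨i, b, d, rfl⟩ := exists_eq_branchVertex v
  rw [branchVertex_mem_verts] at hv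
  rw [Ne, branchVertex_inj] at hne
  replace hv := hv.resolve_left hne
  rw [par_branchVertex]
  split_ifs with h1 h2
  · rw [rk_branchVertex, rk_branchVertex]; omega
  · rw [rk_branchVertex, rk_branchVertex]; omega
  -- The rank drops from `i * (l + 1) + 1` to `(i - 1) * (l + 1) + l = i * (l + 1) - 1`, for the
  -- original `i`.
  · obtain ⟨i, rfl⟩ : ∃ k, i = k + 1 := ⟨i - 1, by omega⟩
    rw [rk_branchVertex, rk_branchVertex, Nat.add_sub_cancel, Nat.succ_mul]
    omega

/-- The tree consisting of the first `n + 1` stages. -/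
noncomputable def branchTree (hl : 1 ≤ l) : WTree :=
  WTree.ofParent (p.verts n) (branchVertex 0 false 0) p.par p.rk (p.finite_verts n)
    (p.home_mem_verts n) (p.par_mem_verts n hl) (p.rk_par_lt n)

theorem rootedBy (hl : 1 ≤ l) : RootedBy (p.branchTree n hl) p.par p.rk :=
  WTree.ofParent_rootedBy _ _ _ _ (by rw [par_branchVertex]; simp)

theorem branchTree_verts (hl : 1 ≤ l) : (p.branchTree n hl).tree.verts = p.verts n := rfl

theorem branchTree_home (hl : 1 ≤ l) : (p.branchTree n hl).home = branchVertex 0 false 0 := rfl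

theorem branchTree_weight (hl : 1 ≤ l) (e : Sym2 ℕ) : (p.branchTree n hl).weight e = 1 := rfl

theorem reached_branchTree (hl : 1 ≤ l) (p' : BranchData l) (n' : ℕ) (m : Move) :
    reached (p.branchTree n hl) m = reached (p'.branchTree n' hl) m := by cases m <;> rfl

/-- Two data agree before stage `i`. -/
def AgreeBefore (p p' : BranchData l) (i : ℕ) : Prop :=
  ∀ j < i, p.side j = p'.side j ∧ p.len j = p'.len j

variable {p}

theorem AgreeBefore.branchLen_eq {p' : BranchData l} {i j : ℕ} (h : p.AgreeBefore p' i)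
    (hj : j < i) (b : Bool) : p.branchLen j b = p'.branchLen j b := by
  simp [branchLen, h j hj]

theorem AgreeBefore.symm {p' : BranchData l} {i : ℕ} (h : p.AgreeBefore p' i) :
    p'.AgreeBefore p i := fun j hj => ⟨(h j hj).1.symm, (h j hj).2.symm⟩

theorem one_le_branchLen (hl : 1 ≤ l) {i : ℕ} (hi : 1 ≤ i) (b : Bool) : 1 ≤ p.branchLen i b := by
  have := p.len_pos i hi
  unfold branchLen
  split_ifs <;> omega

/-- The edges at a vertex that is not too deep in stage `i` do not depend on the later stages. -/
theorem adj_of_agreeBefore (hl : 1 ≤ l) {p' : BranchData l} {i n n' : ℕ} (hi : 1 ≤ i) (hn' : i ≤ n')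
    (h : p.AgreeBefore p' i) {j : ℕ} {b : Bool} {d y : ℕ} (hj : j ≤ i)
    (hx : branchVertex j b d ∈ p'.verts n')
    (hd : j = i → d < p.branchLen i b ∧ d < p'.branchLen i b)
    (hadj : (p.branchTree n hl).tree.Adj (branchVertex j b d) y) :
    (p'.branchTree n' hl).tree.Adj (branchVertex j b d) y := by
  obtain ⟨hx1, hy, hh⟩ := ((p.rootedBy n hl).adj_iff _ _).1 hadj
  have hlb := p.branchLen_le i b
  have hpar : ∀ b d, j ≤ i → p.par (branchVertex j b d) = p'.par (branchVertex j b d) := by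
    intro b d hj
    rw [par_branchVertex, par_branchVertex]
    split_ifs with h1 h2
    · rfl
    · rfl
    · rw [(h (j - 1) (by omega)).1]
  rcases hh with ⟨hne, hp⟩ | ⟨hne, hp⟩
  · obtain ⟨k, c, e, rfl⟩ := exists_eq_branchVertex y
    rw [branchTree_home, Ne, branchVertex_inj] at hne
    rw [branchTree_verts, branchVertex_mem_verts] at hy
    replace hy := hy.resolve_left hne
    have key : branchVertex k c e ∈ p'.verts n' ∧ p'.par (branchVertex k c e) =
        branchVertex j b d := by
      rw [branchVertex_mem_verts]
      rw [par_branchVertex] at hp ⊢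
      split_ifs at hp ⊢ with h1 h2
      · rw [branchVertex_inj] at hp
        obtain ⟨rfl, rfl, rfl⟩ := hp
        refine ⟨Or.inr ⟨by omega, by omega, ?_⟩, rfl⟩
        rcases Nat.lt_or_ge k i with hk | hk
        · rw [← h.branchLen_eq hk]; omega
        · obtain rfl : k = i := le_antisymm hj hk
          have := hd rfl; omega
      · refine ⟨Or.inr ⟨by omega, by omega, ?_⟩, hp⟩
        rw [← h.branchLen_eq (by omega)]; omega
      · rw [branchVertex_inj] at hp
        obtain ⟨rfl, rfl, rfl⟩ := hp
        -- Only a vertex at depth `l` of stage `i` sees a later stage, and `hd` excludes it because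
        -- no branch is longer than `l`.
        have hlt : k - 1 < i := by
          rcases Nat.lt_or_ge (k - 1) i with hk | hk
          · exact hk
          · have := hd (le_antisymm hj hk); omega
        refine ⟨Or.inr ⟨by omega, by omega, ?_⟩, by rw [(h _ hlt).1]⟩
        have := p'.one_le_branchLen hl (i := k) (by omega) c
        omega
    exact ((p'.rootedBy n' hl).adj_iff _ _).2 ⟨hx, key.1, Or.inl ⟨by
      rw [branchTree_home, Ne, branchVertex_inj]; exact hne, key.2⟩⟩
  · refine ((p'.rootedBy n' hl).adj_iff _ _).2 ⟨hx, ?_, Or.inr ⟨hne, ?_⟩⟩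
    · rw [← hp, hpar b d hj]
      exact (p'.rootedBy n' hl).par_mem _ hx
    · rw [← hpar b d hj, hp]

end BranchData

/-! ### The adversary -/

/-- A vertex other than the homebase is entered from its parent or from a child. In the second case
the child was reached before, so by induction the vertex, and then its parent, had been reached
already. -/
theorem RootedBy.reached_par {T : WTree} {par rk : ℕ → ℕ} (R : RootedBy T par rk)
    {ms : List Move} (h : Legal T [] ms) {x : ℕ} (hx : ∃ m ∈ ms, reached T m = x)
    (hne : x ≠ T.home) : ∃ m ∈ ms, reached T m = par x := by
  induction ms using List.reverseRecOn generalizing x with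
  | nil => simp at hx
  | append_singleton ms m ih =>
    obtain ⟨h1, h2⟩ := (legal_append _ _ _ _).1 h
    have hold : ∀ y, (∃ m ∈ ms, reached T m = y) → ∃ m' ∈ ms ++ [m], reached T m' = y :=
      fun y ⟨m', hm', hy⟩ => ⟨m', List.mem_append_left _ hm', hy⟩
    obtain ⟨m', hm', hx⟩ := hx
    rcases List.mem_append.1 hm' with hm' | hm'
    · exact hold _ (ih h1 ⟨m', hm', hx⟩ hne)
    · rw [List.mem_singleton.1 hm'] at hx
      cases m with
      | invoke => exact absurd hx.symm hne
      | traverse a v =>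
        obtain rfl : v = x := hx
        obtain ⟨⟨u, hu, hadj⟩, -⟩ := h2
        have hur := (reached_of_mem_endPos (List.mem_of_getElem? hu)).resolve_left (by simp)
        obtain ⟨-, -, ⟨-, hp⟩ | ⟨hune, hp⟩⟩ := (R.adj_iff u v).1 hadj
        · exact hold _ (hp ▸ hur)
        · exact hold _ (ih h1 (hp ▸ ih h1 hur hune) hne)

theorem mem_set_of_mem_of_ne {pos : List ℕ} {a u v x : ℕ} (hu : pos[a]? = some u) (hx : x ∈ pos)
    (hne : x ≠ u) : x ∈ pos.set a v := by
  obtain ⟨k, hk⟩ := List.mem_iff_getElem?.1 hx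
  refine List.mem_iff_getElem?.2 ⟨k, ?_⟩
  rw [List.getElem?_set_ne, hk]
  rintro rfl
  rw [hu] at hk
  exact hne (Option.some.inj hk).symm

/-- Both branches of stage `i` are occupied. -/
def BothOccupied (i : ℕ) (pos : List ℕ) : Prop :=
  ∀ b, ∃ d, branchVertex i b d ∈ pos

/-- Both branches of stage `i` are occupied, or depth `l` is reached in one of them. -/
def StageOver (l i : ℕ) (pos : List ℕ) : Prop :=
  BothOccupied i pos ∨ ∃ b, branchVertex i b l ∈ pos

/-! ### The choice of side branches against a given strategy. -/

namespace BranchData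

variable {l : ℕ} {p : BranchData l}

/-- When stage `i` is decided, the side branch is empty and explored up to its last vertex, and
afterwards both branches are occupied or the next branching vertex is reached. -/
def StageSplit (p : BranchData l) (i : ℕ) (home : ℕ) (reach : Move → ℕ) (ms : List Move) : Prop :=
  ∃ pre m post, ms = pre ++ m :: post ∧
    (∀ d, branchVertex i (!p.side i) d ∉ endPos home [] pre) ∧
    (∀ d, 1 ≤ d → d < p.len i → ∃ m ∈ pre, reach m = branchVertex i (!p.side i) d) ∧
    (¬ ∃ m ∈ pre, reach m = branchVertex i (!p.side i) (p.len i)) ∧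
    (BothOccupied i (endPos home [] (pre ++ [m])) ∨
      branchVertex i (p.side i) l ∈ endPos home [] (pre ++ [m]))

/-- The data in which the side branch of stage `i` has the maximal length. -/
def fullStage (p : BranchData l) (hl : 1 ≤ l) (i : ℕ) (hi : 1 ≤ i) : BranchData l where
  side := p.side
  len := Function.update p.len i l
  len_le := fun j => by
    rcases eq_or_ne j i with rfl | h
    · simp
    · simpa [h] using p.len_le j
  len_zero := by rw [Function.update_of_ne (by omega), p.len_zero]
  len_pos := fun j hj => by
    rcases eq_or_ne j i with rfl | h
    · simpa
    · simpa [h] using p.len_pos j hj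

theorem fullStage_branchLen (hl : 1 ≤ l) (i : ℕ) (hi : 1 ≤ i) (b : Bool) :
    (p.fullStage hl i hi).branchLen i b = l := by
  simp [branchLen, fullStage]

theorem fullStage_agreeBefore (hl : 1 ≤ l) (i : ℕ) (hi : 1 ≤ i) :
    (p.fullStage hl i hi).AgreeBefore p i := by
  intro j hj
  simp [fullStage, hj.ne]

theorem not_adj_of_branch_ne (hl : 1 ≤ l) {n i : ℕ} (hi : 1 ≤ i) {b c : Bool} {d e : ℕ}
    (hbc : b ≠ c) : ¬ (p.branchTree n hl).tree.Adj (branchVertex i b d) (branchVertex i c e) := by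
  intro h
  have key : ∀ {b c : Bool} {d e : ℕ}, b ≠ c →
      p.par (branchVertex i b d) ≠ branchVertex i c e := by
    intro b c d e hbc hp
    rw [par_branchVertex] at hp
    split_ifs at hp with h1 h2
    · exact hbc (branchVertex_inj.1 hp).2.1
    · have := (branchVertex_inj.1 hp).1; omega
    · have := (branchVertex_inj.1 hp).1; omega
  obtain ⟨-, -, ⟨-, hp⟩ | ⟨-, hp⟩⟩ := ((p.rootedBy n hl).adj_iff _ _).1 h
  · exact key hbc.symm hp
  · exact key hbc hp

/-- At the move that ends the stage, one of the branches has been empty. -/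
theorem exists_empty_branch (hl : 1 ≤ l) {n i : ℕ} (hi : 1 ≤ i) {pre : List Move} {m : Move}
    (hlegal : Legal (p.branchTree n hl) [] (pre ++ [m]))
    (hpre : ¬ StageOver l i (endPos (branchVertex 0 false 0) [] pre))
    (hover : StageOver l i (endPos (branchVertex 0 false 0) [] (pre ++ [m]))) :
    ∃ b, (∀ d, branchVertex i (!b) d ∉ endPos (branchVertex 0 false 0) [] pre) ∧
      (BothOccupied i (endPos (branchVertex 0 false 0) [] (pre ++ [m])) ∨
        branchVertex i b l ∈ endPos (branchVertex 0 false 0) [] (pre ++ [m])) := by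
  have hl2 := ((legal_append _ _ _ _).1 hlegal).2
  rw [branchTree_home] at hl2
  rw [endPos_append] at hover ⊢
  set pos := endPos (branchVertex 0 false 0) [] pre with hpos
  rw [StageOver, not_or] at hpre
  by_cases hboth : BothOccupied i (endPos (branchVertex 0 false 0) pos [m])
  · have := hpre.1
    simp only [BothOccupied, not_forall, not_exists] at this
    obtain ⟨b, hb⟩ := this
    exact ⟨!b, by simpa using hb, Or.inl hboth⟩
  · obtain ⟨b, hb⟩ := hover.resolve_left hboth
    refine ⟨b, fun d hd => ?_, Or.inr hb⟩
    cases m with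
    | invoke =>
      simp only [endPos, List.mem_append, List.mem_singleton, branchVertex_inj] at hb
      rcases hb with hb | hb
      · exact hpre.2 ⟨b, hb⟩
      · omega
    | traverse a v =>
      obtain ⟨⟨u, hu, hadj⟩, -⟩ := hl2
      change branchVertex i b l ∈ pos.set a v at hb
      rcases List.mem_or_eq_of_mem_set hb with hb' | hb'
      · exact hpre.2 ⟨b, hb'⟩
      -- The mover that arrives at depth `l` cannot come from the other branch, as no edge joins the
      -- two. An agent in the other branch would therefore stay there and both branches would be
      -- occupied.
      · by_cases hdu : branchVertex i (!b) d = u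
        · rw [← hdu, ← hb'] at hadj
          exact not_adj_of_branch_ne hl hi (by simp) hadj
        · have hd' := mem_set_of_mem_of_ne (v := v) hu hd hdu
          refine hboth fun c => ?_
          by_cases hcb : c = b
          · exact ⟨l, hcb ▸ hb⟩
          · obtain rfl : c = !b := by cases b <;> cases c <;> simp_all
            exact ⟨d, hd'⟩

/-- The strategy is run on the tree `U` that ends with two full branches of length `l` in stage `i`,
up to the move that ends the stage. The branch that is empty before this move becomes the side
branch, cut at its first unreached depth `k`. The vertices seen until then have the same edges in
every tree that respects these choices, so the run there begins with the same moves, whatever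
follows. -/
theorem exists_stage_choice (hl : 1 ≤ l) (S : OnlineStrategy) (p : BranchData l) (i : ℕ)
    (hi : 1 ≤ i) :
    ∃ (σ : Bool) (k : ℕ), 1 ≤ k ∧ k ≤ l ∧ ∀ p' : BranchData l, p.AgreeBefore p' i →
      p'.side i = σ → p'.len i = k → ∀ n, i ≤ n →
      p'.StageSplit i (branchVertex 0 false 0) (reached (p'.branchTree n hl))
        (S.moves (p'.branchTree n hl)) := by
  classical
  set r := p.fullStage hl i hi with hr
  set U := r.branchTree i hl with hU
  set h0 := branchVertex 0 false 0 with hh0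
  set ms := S.moves U with hms
  have hex : Explores U ms := S.explores_moves U
  have hrun : IsRun S.next U ms := (S.performs_moves U).1
  have hRL : ∀ b, r.branchLen i b = l := fun b => p.fullStage_branchLen hl i hi b
  have hover : ∃ t, StageOver l i (endPos h0 [] (ms.take t)) := by
    have hv : branchVertex i true l ∈ U.tree.verts := by
      rw [hU, branchTree_verts, branchVertex_mem_verts]
      exact Or.inr ⟨le_rfl, hl, (hRL _).ge⟩
    obtain ⟨m₁, m₂, h, hm⟩ := exists_split_of_reached hex.1 (hex.2 _ hv)
    refine ⟨m₁.length, Or.inr ⟨true, ?_⟩⟩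
    rw [h, List.take_left]
    exact hm
  have hmin : ∀ t < Nat.find hover, ¬ StageOver l i (endPos h0 [] (ms.take t)) :=
    fun t => Nat.find_min hover
  have hspec := Nat.find_spec hover
  -- The stage is not over at time 0, when there are no agents; hence a last time `t` before its end
  -- exists.
  obtain ⟨t, ht⟩ : ∃ t, Nat.find hover = t + 1 := by
    refine ⟨Nat.find hover - 1, ?_⟩
    rcases Nat.eq_zero_or_pos (Nat.find hover) with h | h
    · rw [h] at hspec
      rcases hspec with hs | ⟨b, hs⟩
      · obtain ⟨d, hd⟩ := hs true
        simp [endPos] at hd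
      · simp [endPos] at hs
    · omega
  rw [ht] at hmin hspec
  have htl : t < ms.length := by
    by_contra hge
    refine hmin t (by omega) ?_
    rwa [List.take_of_length_le (by omega : ms.length ≤ t), ← List.take_of_length_le
      (by omega : ms.length ≤ t + 1)]
  set pre := ms.take t with hpre
  set m := ms[t] with hm
  have htake : ms.take (t + 1) = pre ++ [m] := by
    rw [hpre, hm, List.take_append_getElem]
  have hms' : ms = (pre ++ [m]) ++ ms.drop (t + 1) := by rw [← htake, List.take_append_drop]
  rw [htake] at hspec
  have hlegal : Legal U [] (pre ++ [m]) := by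
    have := hex.1
    rw [hms'] at this
    exact ((legal_append _ _ _ _).1 this).1
  have hlegal' : Legal U [] pre := ((legal_append _ _ _ _).1 hlegal).1
  have hrun' : IsRun S.next U (pre ++ [m]) := by
    rw [hms'] at hrun
    exact hrun.of_append
  obtain ⟨σ, hempty, hend⟩ := exists_empty_branch (p := r) hl hi hlegal
    (hmin t (by omega)) hspec
  have hdeep : ∀ b, ¬ ∃ m ∈ pre, reached U m = branchVertex i b l := by
    intro b hb
    obtain ⟨m₁, m₂, h, hm⟩ := exists_split_of_reached hlegal' hb
    have hlen : m₁.length ≤ t := by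
      have := congrArg List.length h
      rw [List.length_append, hpre, List.length_take] at this
      omega
    refine hmin m₁.length (by omega) (Or.inr ⟨b, ?_⟩)
    have : ms.take m₁.length = m₁ := by
      rw [hms', h]
      simp
    rw [this]
    exact hm
  -- Depth `l` is unreached by `hdeep`, so a least unreached depth exists and is at most `l`.
  have hk : ∃ k, 1 ≤ k ∧ ¬ ∃ m ∈ pre, reached U m = branchVertex i (!σ) k := ⟨l, hl, hdeep _⟩
  set k := Nat.find hk with hkdef
  obtain ⟨hk1, hk2⟩ := Nat.find_spec hk
  have hkl : k ≤ l := Nat.find_min' hk ⟨hl, hdeep _⟩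
  have hkmin : ∀ d, 1 ≤ d → d < k → ∃ m ∈ pre, reached U m = branchVertex i (!σ) d := by
    intro d hd hdk
    by_contra h
    exact Nat.find_min hk hdk ⟨hd, h⟩
  -- vertices beyond an unreached one are unreached
  have hbeyond : ∀ b e, 1 ≤ e → (¬ ∃ m ∈ pre, reached U m = branchVertex i b e) →
      ∀ d, e ≤ d → ¬ ∃ m ∈ pre, reached U m = branchVertex i b d := by
    intro b e he hne d hd
    induction d, hd using Nat.le_induction with
    | base => exact hne
    | succ d hd ih =>
      intro hx
      refine ih ?_
      have := (r.rootedBy i hl).reached_par hlegal' hx (by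
        rw [branchTree_home, Ne, branchVertex_inj]; omega)
      rw [par_branchVertex, if_pos (by omega)] at this
      exact this
  refine ⟨σ, k, hk1, hkl, fun p' hagree hside hlen n hin => ?_⟩
  set T := p'.branchTree n hl with hT
  have hag : r.AgreeBefore p' i := fun j hj =>
    ⟨((p.fullStage_agreeBefore hl i hi) j hj).1.trans (hagree j hj).1,
      ((p.fullStage_agreeBefore hl i hi) j hj).2.trans (hagree j hj).2⟩
  have hreach : ∀ m, reached T m = reached U m := reached_branchTree p' n hl _ _
  have hobs : ∀ m ∈ pre, observe T m = observe U m := by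
    intro m' hm'
    obtain ⟨j, b, d, hx⟩ := exists_eq_branchVertex (reached U m')
    have hreachx : ∃ m ∈ pre, reached U m = branchVertex j b d := ⟨m', hm', hx⟩
    have hxU : branchVertex j b d ∈ r.verts i := by
      obtain ⟨m₁, m₂, h, hm⟩ := exists_split_of_reached hlegal' hreachx
      have hl1 : Legal U [] m₁ := by
        rw [h] at hlegal'
        exact ((legal_append _ _ _ _).1 hlegal').1
      exact endPos_mem_verts hl1 (by simp) _ hm
    have hxU' := hxU
    rw [branchVertex_mem_verts] at hxU'
    have hj : j ≤ i := by omega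
    -- Vertices seen in stage `i` lie strictly above the ends of their branches in both trees: above
    -- depth `l` by `hdeep`, and above depth `k` in the side branch by the choice of `k`.
    have hd : j = i → d < r.branchLen i b ∧ d < p'.branchLen i b := by
      rintro rfl
      rw [hRL]
      have hdl : d < l := by
        by_contra hge
        exact hbeyond b l hl (hdeep b) d (by omega) hreachx
      refine ⟨hdl, ?_⟩
      unfold branchLen
      split_ifs with hb
      · exact hdl
      · obtain rfl : b = !σ := by rw [hside] at hb; exact Bool.eq_not.2 hb
        rw [hlen]
        by_contra hge
        exact hbeyond _ k hk1 hk2 d (by omega) hreachx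
    have hxT : branchVertex j b d ∈ p'.verts n := by
      rw [branchVertex_mem_verts]
      refine hxU'.imp_right fun h => ⟨by omega, h.2.1, ?_⟩
      rcases Nat.lt_or_ge j i with hji | hji
      · rw [← hag.branchLen_eq hji]; exact h.2.2
      · obtain rfl : j = i := le_antisymm hj hji
        exact (hd rfl).2.le
    have hadj : ∀ y, T.tree.Adj (branchVertex j b d) y ↔ U.tree.Adj (branchVertex j b d) y :=
      fun y => ⟨adj_of_agreeBefore hl hi le_rfl hag.symm hj hxU fun h => (hd h).symm,
        adj_of_agreeBefore hl hi hin hag hj hxT hd⟩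
    simp only [observe, hreach, hx, hadj]
    rfl
  have hhist : ∀ c, history T (pre.take c) = history U (pre.take c) := fun c =>
    List.map_congr_left fun m' hm' => hobs m' (List.mem_of_mem_take hm')
  have hrunT : IsRun S.next T (pre ++ [m]) := by
    intro c hc
    rw [← hrun' c hc]
    have hc' : c ≤ pre.length := by simp at hc; omega
    -- The move `m` depends only on the history of `pre`, so it is also the next move on `T`, even
    -- though what it reveals may differ.
    rw [List.take_append_of_le_length hc', hhist]
  obtain ⟨post, hpost⟩ := hrunT.prefix_of_performs (S.performs_moves T)
  refine ⟨pre, m, post, by rw [← hpost]; simp, ?_, ?_, ?_, ?_⟩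
  · rw [hside]; exact hempty
  · rw [hside, hlen]
    intro d h1 h2
    obtain ⟨m', hm', h⟩ := hkmin d h1 h2
    exact ⟨m', hm', (hreach m').trans h⟩
  · rw [hside, hlen]
    rintro ⟨m', hm', h⟩
    exact hk2 ⟨m', hm', (hreach m').symm.trans h⟩
  · rw [hside]; exact hend

/-- The adversary chooses all stages. -/
theorem exists_stageSplit (hl : 1 ≤ l) (S : OnlineStrategy) :
    ∃ p : BranchData l, ∀ i, 1 ≤ i → i ≤ l →
      p.StageSplit i (branchVertex 0 false 0) (reached (p.branchTree l hl))
        (S.moves (p.branchTree l hl)) := by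
  -- The claim covers all data that agree through stage `i` and all numbers of stages, so later
  -- choices cannot spoil earlier stages.
  have key : ∀ N, ∃ p : BranchData l, ∀ i, 1 ≤ i → i ≤ N → ∀ p' : BranchData l,
      p.AgreeBefore p' (i + 1) → ∀ n, i ≤ n →
      p'.StageSplit i (branchVertex 0 false 0) (reached (p'.branchTree n hl))
        (S.moves (p'.branchTree n hl)) := by
    intro N
    induction N with
    | zero =>
      refine ⟨⟨fun _ => true, fun i => if i = 0 then 0 else 1, fun i => ?_, by simp, fun i hi => ?_⟩,
        fun i h1 h2 => by omega⟩
      · split_ifs <;> omega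
      · simp [show i ≠ 0 by omega]
    | succ N ih =>
      obtain ⟨p, hp⟩ := ih
      obtain ⟨σ, k, hk1, hkl, hk⟩ := exists_stage_choice hl S p (N + 1) (by omega)
      refine ⟨⟨Function.update p.side (N + 1) σ, Function.update p.len (N + 1) k, fun j => ?_, ?_,
        fun j hj => ?_⟩, fun i h1 h2 p' hp' => ?_⟩
      · rcases eq_or_ne j (N + 1) with rfl | h
        · simpa
        · simpa [h] using p.len_le j
      · rw [Function.update_of_ne (by omega), p.len_zero]
      · rcases eq_or_ne j (N + 1) with rfl | h
        · simpa
        · simpa [h] using p.len_pos j hj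
      · rcases Nat.lt_or_ge i (N + 1) with hi | hi
        · refine hp i h1 (by omega) p' fun j hj => ?_
          have := hp' j hj
          simpa [show j ≠ N + 1 by omega] using this
        · obtain rfl : i = N + 1 := by omega
          refine hk p' (fun j hj => ?_) ?_ ?_
          · have := hp' j (by omega)
            simpa [show j ≠ N + 1 by omega] using this
          · have := (hp' (N + 1) (by omega)).1
            simpa using this.symm
          · have := (hp' (N + 1) (by omega)).2
            simpa using this.symm
  obtain ⟨p, hp⟩ := key l
  exact ⟨p, fun i h1 h2 => hp i h1 h2 p (fun _ _ => ⟨rfl, rfl⟩) l h2⟩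

end BranchData

/-! ### Lower bound on the distance traversed on the adversary's tree -/

theorem agentsIn_mono {D D' : Set ℕ} (h : D ⊆ D') (pos : List ℕ) :
    agentsIn D pos ≤ agentsIn D' pos := by
  have := agentsIn_add_le (Set.empty_subset D') h (Set.empty_disjoint D) pos
  omega

theorem sum_agentsIn_le {ι : Type*} (s : Finset ι) (D : ι → Set ℕ) {E : Set ℕ}
    (hE : ∀ i ∈ s, D i ⊆ E) (hd : ∀ i j, i ≠ j → Disjoint (D i) (D j)) (pos : List ℕ) :
    ∑ i ∈ s, agentsIn (D i) pos ≤ agentsIn E pos := by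
  classical
  refine le_trans ?_ (agentsIn_mono (Set.iUnion₂_subset hE) pos)
  clear hE
  induction s using Finset.induction_on with
  | empty => simp
  | insert a s ha ih =>
    rw [Finset.sum_insert ha, Finset.set_biUnion_insert]
    refine (Nat.add_le_add_left ih _).trans ?_
    refine agentsIn_add_le Set.subset_union_left Set.subset_union_right ?_ pos
    exact Set.disjoint_iUnion₂_right.2 fun j hj => hd a j fun h => ha (h ▸ hj)

theorem two_le_agentsIn {D₁ D₂ D : Set ℕ} {pos : List ℕ} (h₁ : D₁ ⊆ D) (h₂ : D₂ ⊆ D)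
    (hd : Disjoint D₁ D₂) (hp₁ : ∃ x ∈ pos, x ∈ D₁) (hp₂ : ∃ x ∈ pos, x ∈ D₂) :
    2 ≤ agentsIn D pos := by
  have := agentsIn_add_le h₁ h₂ hd pos
  have := agentsIn_pos_iff.2 hp₁
  have := agentsIn_pos_iff.2 hp₂
  omega

theorem mem_descendants_of_par {par : ℕ → ℕ} {v x : ℕ} (h : par x ∈ descendants par v) :
    x ∈ descendants par v := by
  obtain ⟨k, hk⟩ := h
  exact ⟨k + 1, hk⟩

theorem descendants_trans {par : ℕ → ℕ} {v x : ℕ} (h : x ∈ descendants par v) :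
    descendants par x ⊆ descendants par v := by
  rintro y ⟨k, rfl⟩
  obtain ⟨k', rfl⟩ := h
  exact ⟨k' + k, Function.iterate_add_apply _ _ _ _⟩

/-! ### Descendants and crossing counts in the adversary's tree. -/

namespace BranchData

variable {l : ℕ} {p : BranchData l}

theorem mem_descendants_of_le (i : ℕ) (b : Bool) {d d' : ℕ} (hd : 1 ≤ d) (h : d ≤ d') :
    branchVertex i b d' ∈ descendants p.par (branchVertex i b d) := by
  induction d', h using Nat.le_induction with
  | base => exact ⟨0, rfl⟩
  | succ e he ih =>
    refine mem_descendants_of_par ?_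
    rwa [par_branchVertex, if_pos (by omega), Nat.add_sub_cancel]

/-- Later stages are below the spine edges of earlier stages. -/
theorem mem_descendants_of_lt (hl : 1 ≤ l) {j i : ℕ} (hji : j < i) (b : Bool) {d d' : ℕ}
    (hd : 1 ≤ d) (hdl : d ≤ l) (hd' : 1 ≤ d') :
    branchVertex i b d' ∈ descendants p.par (branchVertex j (p.side j) d) := by
  induction i, hji using Nat.le_induction generalizing b d' with
  | base =>
    refine descendants_trans (mem_descendants_of_par ?_) (mem_descendants_of_le _ b le_rfl hd')
    rw [par_branchVertex, if_neg (by omega), if_neg (by omega)]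
    exact mem_descendants_of_le _ _ hd hdl
  | succ i hi ih =>
    refine descendants_trans (mem_descendants_of_par ?_) (mem_descendants_of_le _ b le_rfl hd')
    rw [par_branchVertex, if_neg (by omega), if_neg (by omega), Nat.add_sub_cancel]
    exact ih (p.side i) hl

/-- Only the side branch is below its edges. -/
theorem eq_of_mem_descendants_side {i d x : ℕ} (hi : 1 ≤ i)
    (h : x ∈ descendants p.par (branchVertex i (!p.side i) d)) :
    ∃ d', x = branchVertex i (!p.side i) d' := by
  obtain ⟨k, hk⟩ := h
  induction k generalizing x with
  | zero => exact ⟨d, hk⟩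
  | succ k ih =>
    obtain ⟨d', hd'⟩ := ih (x := p.par x) hk
    obtain ⟨j, b, e, rfl⟩ := exists_eq_branchVertex x
    rw [par_branchVertex] at hd'
    split_ifs at hd' with h1 h2
    · obtain ⟨rfl, rfl, -⟩ := branchVertex_inj.1 hd'
      exact ⟨e, rfl⟩
    · have := (branchVertex_inj.1 hd').1; omega
    · obtain ⟨rfl, h3, -⟩ := branchVertex_inj.1 hd'
      simp at h3

/-- The side branch is not below the spine edges of its stage. -/
theorem side_notMem_descendants {i d e : ℕ} (hi : 1 ≤ i) :
    branchVertex i (!p.side i) e ∉ descendants p.par (branchVertex i (p.side i) d) := by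
  -- Iterated parents of a side vertex stay in the side branch or fall into earlier stages.
  have key : ∀ k, (∃ e', p.par^[k] (branchVertex i (!p.side i) e) =
      branchVertex i (!p.side i) e') ∨
      ∃ j b d, j < i ∧ p.par^[k] (branchVertex i (!p.side i) e) = branchVertex j b d := by
    intro k
    induction k with
    | zero => exact Or.inl ⟨e, rfl⟩
    | succ k ih =>
      rw [Function.iterate_succ_apply']
      rcases ih with ⟨e', he⟩ | ⟨j, b, d, hj, he⟩ <;> rw [he, par_branchVertex] <;> split_ifs
      · exact Or.inl ⟨_, rfl⟩
      · exact Or.inr ⟨0, false, 0, by omega, rfl⟩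
      · exact Or.inr ⟨_, _, _, by omega, rfl⟩
      · exact Or.inr ⟨_, _, _, hj, rfl⟩
      · exact Or.inr ⟨0, false, 0, by omega, rfl⟩
      · exact Or.inr ⟨_, _, _, by omega, rfl⟩
  rintro ⟨k, hk⟩
  rcases key k with ⟨e', he⟩ | ⟨j, b, d', hj, he⟩
  · have := (branchVertex_inj.1 (hk.symm.trans he)).2.1
    simp at this
  · have := (branchVertex_inj.1 (hk.symm.trans he)).1
    omega

/-- The vertices of the side branch of stage `i`. -/
def sideSet (p : BranchData l) (i : ℕ) : Set ℕ := {x | ∃ d, 1 ≤ d ∧ x = branchVertex i (!p.side i) d}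

/-- The number of traversals of the edge from `branchVertex i b d` to its parent. -/
def branchCrossings (p : BranchData l) (ms : List Move) (i : ℕ) (b : Bool) (d : ℕ) : ℕ :=
  crossings (branchVertex 0 false 0) s(branchVertex i b d, p.par (branchVertex i b d)) [] ms

theorem agentsIn_descendants (hl : 1 ≤ l) (n i : ℕ) (b : Bool) {d : ℕ} (hd : 1 ≤ d)
    {pos : List ℕ} {ms : List Move} (h : Legal (p.branchTree n hl) pos ms) :
    agentsIn (descendants p.par (branchVertex i b d)) (endPos (branchVertex 0 false 0) pos ms) ≤
      agentsIn (descendants p.par (branchVertex i b d)) pos +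
        crossings (branchVertex 0 false 0)
          s(branchVertex i b d, p.par (branchVertex i b d)) pos ms ∧
    agentsIn (descendants p.par (branchVertex i b d)) pos ≤
      agentsIn (descendants p.par (branchVertex i b d)) (endPos (branchVertex 0 false 0) pos ms) +
        crossings (branchVertex 0 false 0)
          s(branchVertex i b d, p.par (branchVertex i b d)) pos ms := by
  refine agentsIn_endPos (T := p.branchTree n hl) ?_ ?_ h
  · refine (p.rootedBy n hl).home_notMem_descendants ?_
    rw [branchTree_home, Ne, branchVertex_inj]
    omega
  · exact (p.rootedBy n hl).descendants_cut (v := branchVertex i b d)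

/-- Before the decision, depth `d` was visited and the branch was empty again: two crossings. The
end of the branch is visited only later: a third. If nobody finishes in the branch, someone comes
back: a fourth. The bound `d < p.len i` excludes the last edge, which need not have been crossed
before the decision. -/
theorem StageSplit.side_crossings (hl : 1 ≤ l) {i : ℕ} (hi : 1 ≤ i) (hil : i ≤ l) {ms : List Move}
    (hex : Explores (p.branchTree l hl) ms)
    (h : p.StageSplit i (branchVertex 0 false 0) (reached (p.branchTree l hl)) ms)
    {d : ℕ} (hd : 1 ≤ d) (hdl : d < p.len i) :
    3 ≤ p.branchCrossings ms i (!p.side i) d ∧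
    ((∀ x ∈ endPos (branchVertex 0 false 0) [] ms, x ∉ p.sideSet i) →
      4 ≤ p.branchCrossings ms i (!p.side i) d) := by
  obtain ⟨pre, m, post, rfl, hempty, hreached, hleaf, -⟩ := h
  set D := descendants p.par (branchVertex i (!p.side i) d) with hD
  set h0 := branchVertex 0 false 0 with hh0
  obtain ⟨hl1, hl2⟩ := (legal_append _ _ _ _).1 hex.1
  have hzero : agentsIn D (endPos h0 [] pre) = 0 := by
    rw [agentsIn_eq_zero_iff]
    intro x hx hxD
    obtain ⟨d', rfl⟩ := eq_of_mem_descendants_side hi hxD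
    exact hempty d' hx
  have hpre : 2 ≤ crossings h0
      s(branchVertex i (!p.side i) d, p.par (branchVertex i (!p.side i) d)) [] pre := by
    obtain ⟨m₁, m₂, rfl, hm⟩ := exists_split_of_reached hl1 (hreached d hd hdl)
    obtain ⟨hl3, hl4⟩ := (legal_append _ _ _ _).1 hl1
    have h1 := (agentsIn_descendants (p := p) hl l i (!p.side i) hd hl3).1
    have h2 := (agentsIn_descendants (p := p) hl l i (!p.side i) hd hl4).2
    have h3 : 0 < agentsIn D (endPos h0 [] m₁) := agentsIn_pos_iff.2 ⟨_, hm, 0, rfl⟩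
    rw [agentsIn_nil] at h1
    rw [endPos_append] at hzero
    rw [crossings_append]
    change _ ≤ agentsIn D (endPos h0 (endPos h0 [] m₁) m₂) + crossings h0 _ _ _ at h2
    rw [hzero] at h2
    change agentsIn D (endPos h0 [] m₁) ≤ _ at h1
    change agentsIn D (endPos h0 [] m₁) ≤ _ at h2
    change _ ≤ crossings h0 _ [] m₁ + crossings h0 _ (endPos h0 [] m₁) m₂
    simp only [branchTree_home, ← hh0] at h1 h2
    omega
  have hlv : branchVertex i (!p.side i) (p.len i) ∈ (p.branchTree l hl).tree.verts := by
    rw [branchTree_verts, branchVertex_mem_verts]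
    exact Or.inr ⟨hil, p.len_pos i hi, by simp [branchLen]⟩
  have hlr : ∃ m' ∈ m :: post, reached (p.branchTree l hl) m' =
      branchVertex i (!p.side i) (p.len i) := by
    obtain ⟨m', hm', hx⟩ := hex.2 _ hlv
    rcases List.mem_append.1 hm' with hm' | hm'
    · exact absurd ⟨m', hm', hx⟩ hleaf
    · exact ⟨m', hm', hx⟩
  obtain ⟨q₁, q₂, hq, hm⟩ := exists_split_of_reached hl2 hlr
  rw [hq] at hl2 ⊢
  obtain ⟨hl3, hl4⟩ := (legal_append _ _ _ _).1 hl2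
  have h1 := (agentsIn_descendants (p := p) hl l i (!p.side i) hd hl3).1
  have h2 := (agentsIn_descendants (p := p) hl l i (!p.side i) hd hl4).2
  have h3 : 0 < agentsIn D (endPos h0 (endPos h0 [] pre) q₁) :=
    agentsIn_pos_iff.2 ⟨_, hm, mem_descendants_of_le i _ hd hdl.le⟩
  simp only [branchTree_home, ← hh0, ← hD] at h1 h2
  rw [branchCrossings, crossings_append, crossings_append, ← hh0]
  refine ⟨by omega, fun hfin => ?_⟩
  have h4 : agentsIn D (endPos h0 (endPos h0 (endPos h0 [] pre) q₁) q₂) = 0 := by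
    rw [← endPos_append, ← endPos_append, agentsIn_eq_zero_iff]
    intro x hx hxD
    obtain ⟨d', rfl⟩ := eq_of_mem_descendants_side hi hxD
    refine hfin _ hx ⟨d', ?_, rfl⟩
    rw [hq] at hex
    have := endPos_mem_verts hex.1 (by simp) _ hx
    rw [branchTree_verts, branchVertex_mem_verts] at this
    omega
  omega

/-- Two agents beyond an edge at the same time force two crossings of it. If both branches get
occupied, this holds for all earlier segments at once. Otherwise an agent reaches the end of segment
`i`. If some edge of that segment is crossed only once in all, an agent remains below it, and
whoever later visits the end of the side branch is a second agent beyond all earlier segments. -/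
theorem StageSplit.spine_crossings (hl : 1 ≤ l) {i : ℕ} (hi : 1 ≤ i) (hil : i ≤ l)
    {ms : List Move} (hex : Explores (p.branchTree l hl) ms)
    (h : p.StageSplit i (branchVertex 0 false 0) (reached (p.branchTree l hl)) ms) :
    (∀ d, 1 ≤ d → d ≤ l → 2 ≤ p.branchCrossings ms i (p.side i) d) ∨
    ∀ j < i, ∀ d, 1 ≤ d → d ≤ l → 2 ≤ p.branchCrossings ms j (p.side j) d := by
  obtain ⟨pre, m, post, hms, hempty, -, hleaf, hend⟩ := h
  set h0 := branchVertex 0 false 0 with hh0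
  -- two agents beyond stage `j` at the same time
  have htwo : ∀ m₁ m₂, ms = m₁ ++ m₂ → ∀ j d, 1 ≤ d →
      2 ≤ agentsIn (descendants p.par (branchVertex j (p.side j) d)) (endPos h0 [] m₁) →
      2 ≤ p.branchCrossings ms j (p.side j) d := by
    rintro m₁ m₂ rfl j d hd h2
    have h1 := (agentsIn_descendants (p := p) hl l j (p.side j) hd
      ((legal_append _ _ _ _).1 hex.1).1).1
    rw [agentsIn_nil, ← hh0] at h1
    rw [branchCrossings, crossings_append, ← hh0]
    omega
  by_cases hboth : BothOccupied i (endPos h0 [] (pre ++ [m]))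
  · right
    intro j hj d hd hdl
    refine htwo (pre ++ [m]) post (by simp [hms]) j d hd ?_
    have hleg : Legal (p.branchTree l hl) [] (pre ++ [m]) := by
      have := hex.1
      rw [hms, ← List.singleton_append, ← List.append_assoc] at this
      exact ((legal_append _ _ _ _).1 this).1
    have hsub : ∀ b, {x | ∃ e, 1 ≤ e ∧ x = branchVertex i b e} ⊆
        descendants p.par (branchVertex j (p.side j) d) := by
      rintro b x ⟨e, he, rfl⟩
      exact mem_descendants_of_lt hl hj b hd hdl he
    have hocc : ∀ b, ∃ x ∈ endPos h0 [] (pre ++ [m]),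
        x ∈ {x | ∃ e, 1 ≤ e ∧ x = branchVertex i b e} := by
      intro b
      obtain ⟨e, he⟩ := hboth b
      have := endPos_mem_verts hleg (by simp) _ he
      rw [branchTree_verts, branchVertex_mem_verts] at this
      exact ⟨_, he, e, by omega, rfl⟩
    refine two_le_agentsIn (hsub true) (hsub false) ?_ (hocc true) (hocc false)
    rw [Set.disjoint_left]
    rintro x ⟨e, -, rfl⟩ ⟨e', -, h⟩
    simp [branchVertex_inj] at h
  · have hspine := hend.resolve_left hboth
    by_cases hall : ∀ d, 1 ≤ d → d ≤ l → 2 ≤ p.branchCrossings ms i (p.side i) d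
    · exact Or.inl hall
    right
    push Not at hall
    obtain ⟨c, hc1, hcl, hc⟩ := hall
    intro j hj d hd hdl
    have hex1 := hex.1
    rw [hms] at hex1
    obtain ⟨hl1, hl2⟩ := (legal_append _ _ _ _).1 hex1
    have hlv : branchVertex i (!p.side i) (p.len i) ∈ (p.branchTree l hl).tree.verts := by
      rw [branchTree_verts, branchVertex_mem_verts]
      exact Or.inr ⟨hil, p.len_pos i hi, by simp [branchLen]⟩
    have hlr : ∃ m' ∈ m :: post, reached (p.branchTree l hl) m' =
        branchVertex i (!p.side i) (p.len i) := by
      obtain ⟨m', hm', hx⟩ := hex.2 _ hlv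
      rw [hms] at hm'
      rcases List.mem_append.1 hm' with hm' | hm'
      · exact absurd ⟨m', hm', hx⟩ hleaf
      · exact ⟨m', hm', hx⟩
    obtain ⟨q₁, q₂, hq, hm⟩ := exists_split_of_reached hl2 hlr
    -- The side branch is empty before `m`, so its end is occupied only after `m` has been made.
    cases q₁ with
    | nil => exact absurd hm (hempty _)
    | cons m' q =>
      obtain ⟨rfl, rfl⟩ := List.cons_eq_cons.1 hq
      have hms' : ms = (pre ++ [m]) ++ (q ++ q₂) := by simp [hms]
      have hex2 := hex.1
      rw [hms'] at hex2
      obtain ⟨hl3, hl4⟩ := (legal_append _ _ _ _).1 hex2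
      have hl5 := ((legal_append _ _ _ _).1 hl4).1
      have h1 := (agentsIn_descendants (p := p) hl l i (p.side i) hc1 hl3).1
      have h2 := (agentsIn_descendants (p := p) hl l i (p.side i) hc1 hl5).2
      have h3 : 0 < agentsIn (descendants p.par (branchVertex i (p.side i) c))
          (endPos h0 [] (pre ++ [m])) :=
        agentsIn_pos_iff.2 ⟨_, hspine, mem_descendants_of_le i _ hc1 hcl⟩
      rw [agentsIn_nil] at h1
      rw [hms', branchCrossings, crossings_append _ _ _ (pre ++ [m]), crossings_append _ _ _ q,
        ← hh0] at hc
      simp only [branchTree_home, ← hh0] at h1 h2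
      -- Entering below this edge already used one crossing. If everyone had left again, there would
      -- be a second one, against `hc`.
      have h4 : 0 < agentsIn (descendants p.par (branchVertex i (p.side i) c))
          (endPos h0 (endPos h0 [] (pre ++ [m])) q) := by omega
      rw [← endPos_append] at h4
      refine htwo (pre ++ [m] ++ q) q₂ (by simp [hms]) j d hd ?_
      have hm2 : branchVertex i (!p.side i) (p.len i) ∈ endPos h0 [] (pre ++ [m] ++ q) := by
        rw [List.append_assoc, List.singleton_append, endPos_append]
        exact hm
      refine two_le_agentsIn (D₁ := descendants p.par (branchVertex i (p.side i) c))
        (D₂ := {branchVertex i (!p.side i) (p.len i)})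
        (descendants_trans (mem_descendants_of_lt hl hj _ hd hdl hc1))
        (Set.singleton_subset_iff.2 (mem_descendants_of_lt hl hj _ hd hdl (p.len_pos i hi)))
        (Set.disjoint_singleton_right.2 (side_notMem_descendants hi))
        (agentsIn_pos_iff.1 h4) ⟨_, hm2, rfl⟩

/-- Agents that end in different side branches have all left through the first segment. -/
theorem card_le_branchCrossings (hl : 1 ≤ l) {ms : List Move}
    (hex : Explores (p.branchTree l hl) ms) (W : Finset ℕ)
    (hW : ∀ i ∈ W, 1 ≤ i ∧ ∃ x ∈ endPos (branchVertex 0 false 0) [] ms, x ∈ p.sideSet i)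
    {d : ℕ} (hd : 1 ≤ d) (hdl : d ≤ l) : W.card ≤ p.branchCrossings ms 0 (p.side 0) d := by
  have h1 := (agentsIn_descendants (p := p) hl l 0 (p.side 0) hd hex.1).1
  rw [agentsIn_nil, Nat.zero_add] at h1
  refine le_trans ?_ h1
  refine le_trans ?_ (sum_agentsIn_le W p.sideSet ?_ ?_ _)
  · rw [Finset.card_eq_sum_ones]
    exact Finset.sum_le_sum fun i hi => agentsIn_pos_iff.2 (hW i hi).2
  · rintro i hi x ⟨e, he, rfl⟩
    exact mem_descendants_of_lt hl (hW i hi).1 _ hd hdl he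
  · intro i j hij
    rw [Set.disjoint_left]
    rintro x ⟨e, -, rfl⟩ ⟨e', -, h⟩
    exact hij (branchVertex_inj.1 h).1

theorem sum_branchCrossings_le (hl : 1 ≤ l) {ms : List Move}
    (hex : Explores (p.branchTree l hl) ms) :
    ((∑ j ∈ insert 0 (Finset.Icc 1 l), ∑ d ∈ Finset.Icc 1 l,
        p.branchCrossings ms j (p.side j) d +
      ∑ i ∈ Finset.Icc 1 l, ∑ d ∈ Finset.Icc 1 (p.len i),
        p.branchCrossings ms i (!p.side i) d : ℕ) : ℝ) ≤
      totalDistance (p.branchTree l hl) [] ms := by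
  let s : Finset ((Σ _ : ℕ, ℕ) ⊕ (Σ _ : ℕ, ℕ)) :=
    ((insert 0 (Finset.Icc 1 l)).sigma fun _ => Finset.Icc 1 l).disjSum
      ((Finset.Icc 1 l).sigma fun i => Finset.Icc 1 (p.len i))
  let f : (Σ _ : ℕ, ℕ) ⊕ (Σ _ : ℕ, ℕ) → ℕ :=
    Sum.elim (fun x => branchVertex x.1 (p.side x.1) x.2)
      (fun x => branchVertex x.1 (!p.side x.1) x.2)
  have hinj : Function.Injective f := by
    rintro (⟨i, d⟩ | ⟨i, d⟩) (⟨j, e⟩ | ⟨j, e⟩) h <;> obtain ⟨rfl, h1, h2⟩ := branchVertex_inj.1 h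
    · dsimp at h2; rw [h2]
    · simp at h1
    · simp at h1
    · dsimp at h2; rw [h2]
  have := (p.rootedBy l hl).sum_le_totalDistance s f hinj.injOn ?_ hex.1
  · simp only [s, Finset.sum_disjSum, Finset.sum_sigma, branchTree_weight, one_mul, f,
      Sum.elim_inl, Sum.elim_inr] at this
    push_cast
    exact this
  · rintro (⟨i, d⟩ | ⟨i, d⟩) hx <;>
      simp only [s, Finset.inl_mem_disjSum, Finset.inr_mem_disjSum, Finset.mem_sigma,
        Finset.mem_insert, Finset.mem_Icc] at hx
    · simp only [f, Sum.elim_inl, branchTree_verts, branchTree_home, branchVertex_mem_verts, Ne,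
        branchVertex_inj, branchLen, if_true]
      omega
    · simp only [f, Sum.elim_inr, branchTree_verts, branchTree_home, branchVertex_mem_verts, Ne,
        branchVertex_inj, branchLen, Bool.not_eq_self, if_false]
      omega

/-- The loss `6 * l` consists of `2 * l` for one deficient spine segment and 4 for the last edge of
each of the `l` side paths. The missing fourth crossings, at most `l` for each side path in `W`, are
covered by the `l * W.card` crossings of segment 0. -/
theorem le_sum_branchCrossings (hl : 1 ≤ l) {ms : List Move}
    (hex : Explores (p.branchTree l hl) ms)
    (hsplit : ∀ i, 1 ≤ i → i ≤ l →
      p.StageSplit i (branchVertex 0 false 0) (reached (p.branchTree l hl)) ms) :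
    2 * (l * l) + 4 * ∑ i ∈ Finset.Icc 1 l, p.len i ≤
      ∑ j ∈ insert 0 (Finset.Icc 1 l), ∑ d ∈ Finset.Icc 1 l,
        p.branchCrossings ms j (p.side j) d +
      ∑ i ∈ Finset.Icc 1 l, ∑ d ∈ Finset.Icc 1 (p.len i),
        p.branchCrossings ms i (!p.side i) d + 6 * l := by
  classical
  let W : Finset ℕ := (Finset.Icc 1 l).filter fun i =>
    ∃ x ∈ endPos (branchVertex 0 false 0) [] ms, x ∈ p.sideSet i
  have hconst : ∀ (n c : ℕ) (f : ℕ → ℕ), (∀ d, 1 ≤ d → d ≤ n → c ≤ f d) →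
      n * c ≤ ∑ d ∈ Finset.Icc 1 n, f d := by
    intro n c f h
    have := Finset.card_nsmul_le_sum (Finset.Icc 1 n) f c fun d hd =>
      h d (Finset.mem_Icc.1 hd).1 (Finset.mem_Icc.1 hd).2
    simpa using this
  have h0 : l * W.card ≤ ∑ d ∈ Finset.Icc 1 l, p.branchCrossings ms 0 (p.side 0) d := by
    refine hconst l _ _ fun d hd hdl => card_le_branchCrossings hl hex W (fun i hi => ?_) hd hdl
    have := Finset.mem_filter.1 hi
    exact ⟨(Finset.mem_Icc.1 this.1).1, this.2⟩
  have hspine : 2 * (l * l) ≤ ∑ j ∈ Finset.Icc 1 l, ∑ d ∈ Finset.Icc 1 l,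
      p.branchCrossings ms j (p.side j) d + 2 * l := by
    by_cases hall : ∀ i, 1 ≤ i → i ≤ l → ∀ d, 1 ≤ d → d ≤ l →
        2 ≤ p.branchCrossings ms i (p.side i) d
    · have := hconst l (l * 2) _ fun i hi hil => hconst l 2 _ (hall i hi hil)
      nlinarith
    · push Not at hall
      obtain ⟨c, hc1, hcl, e, he1, hel, hce⟩ := hall
      -- If segment `c` is deficient, stage `c` guarantees all earlier segments. A later stage `i`
      -- cannot guarantee all segments before it, as `c` is among them, so it guarantees its own.
      have hgood : ∀ i ∈ (Finset.Icc 1 l).erase c,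
          l * 2 ≤ ∑ d ∈ Finset.Icc 1 l, p.branchCrossings ms i (p.side i) d := by
        intro i hi
        obtain ⟨hic, hi⟩ := Finset.mem_erase.1 hi
        obtain ⟨hi1, hil⟩ := Finset.mem_Icc.1 hi
        refine hconst l 2 _ ?_
        rcases (hsplit i hi1 hil).spine_crossings hl hi1 hil hex with h | h
        · exact h
        · rcases Nat.lt_or_gt_of_ne hic with hlt | hgt
          · rcases (hsplit c hc1 hcl).spine_crossings hl hc1 hcl hex with h' | h'
            · have := h' e he1 hel; omega
            · exact h' i hlt
          · have := h c hgt e he1 hel; omega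
      have h1 := Finset.card_nsmul_le_sum _ _ _ hgood
      have hcm : c ∈ Finset.Icc 1 l := Finset.mem_Icc.2 ⟨hc1, hcl⟩
      rw [Finset.card_erase_of_mem hcm, Nat.card_Icc, smul_eq_mul, Nat.add_sub_cancel] at h1
      have h2 := Finset.sum_le_sum_of_subset
        (f := fun j => ∑ d ∈ Finset.Icc 1 l, p.branchCrossings ms j (p.side j) d)
        (Finset.erase_subset c (Finset.Icc 1 l))
      have h3 : (l - 1) * (l * 2) + 2 * l = 2 * (l * l) := by
        obtain ⟨k, rfl⟩ : ∃ k, l = k + 1 := ⟨l - 1, by omega⟩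
        rw [Nat.add_sub_cancel]; ring
      omega
  have hside : ∀ i ∈ Finset.Icc 1 l, 4 * p.len i ≤
      ∑ d ∈ Finset.Icc 1 (p.len i), p.branchCrossings ms i (!p.side i) d + 4 +
        if i ∈ W then l else 0 := by
    intro i hi
    obtain ⟨hi1, hil⟩ := Finset.mem_Icc.1 hi
    have hsub : ∑ d ∈ Finset.Icc 1 (p.len i - 1), p.branchCrossings ms i (!p.side i) d ≤
        ∑ d ∈ Finset.Icc 1 (p.len i), p.branchCrossings ms i (!p.side i) d :=
      Finset.sum_le_sum_of_subset (Finset.Icc_subset_Icc_right (by omega))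
    have hlen := p.len_pos i hi1
    have hlen' := p.len_le i
    have hc := fun d (hd : 1 ≤ d) (hdl : d ≤ p.len i - 1) =>
      (hsplit i hi1 hil).side_crossings hl hi1 hil hex hd (by omega)
    split_ifs with hW
    · have := hconst (p.len i - 1) 3 _ fun d hd hdl => (hc d hd hdl).1
      omega
    · have hfin : ∀ x ∈ endPos (branchVertex 0 false 0) [] ms, x ∉ p.sideSet i :=
        fun x hx hxs => hW (Finset.mem_filter.2 ⟨hi, x, hx, hxs⟩)
      have := hconst (p.len i - 1) 4 _ fun d hd hdl => (hc d hd hdl).2 hfin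
      omega
  have hsides := Finset.sum_le_sum hside
  rw [← Finset.mul_sum, Finset.sum_add_distrib, Finset.sum_add_distrib, Finset.sum_const,
    Nat.card_Icc, ← Finset.sum_filter, Finset.sum_const, Finset.filter_mem_eq_inter,
    Finset.inter_eq_right.2 (Finset.filter_subset _ _), smul_eq_mul, smul_eq_mul,
    Nat.add_sub_cancel] at hsides
  change _ ≤ _ + W.card * l at hsides
  rw [Finset.sum_insert (by simp)]
  have : W.card * l = l * W.card := Nat.mul_comm _ _
  omega

theorem le_totalDistance (hl : 1 ≤ l) {ms : List Move}
    (hex : Explores (p.branchTree l hl) ms)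
    (hsplit : ∀ i, 1 ≤ i → i ≤ l →
      p.StageSplit i (branchVertex 0 false 0) (reached (p.branchTree l hl)) ms) :
    2 * ((l : ℝ) * l) + 4 * ∑ i ∈ Finset.Icc 1 l, (p.len i : ℝ) - 6 * l ≤
      totalDistance (p.branchTree l hl) [] ms := by
  refine le_trans ?_ (sum_branchCrossings_le hl hex)
  have := le_sum_branchCrossings hl hex hsplit
  have h2 : ((2 * (l * l) + 4 * ∑ i ∈ Finset.Icc 1 l, p.len i : ℕ) : ℝ) ≤ _ :=
    Nat.cast_le.2 this
  rw [Nat.cast_add _ (6 * l)] at h2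
  push_cast at h2 ⊢
  linarith

end BranchData

/-! ### Upper bound on the optimum of a spine tree -/

/-- A single agent can walk from `u` to `v` at distance `c` and visit all of `R` on its way. -/
def HasWalk (T : WTree) (u v : ℕ) (c : ℝ) (R : Set ℕ) : Prop :=
  ∃ ms, Legal T [u] ms ∧ endPos T.home [u] ms = [v] ∧ numAgents ms = 0 ∧
    totalDistance T [u] ms = c ∧ ∀ x ∈ R, ∃ m ∈ ms, reached T m = x

namespace HasWalk

variable {T : WTree}

theorem refl (u : ℕ) : HasWalk T u u 0 ∅ :=
  ⟨[], trivial, rfl, rfl, rfl, by simp⟩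

theorem of_adj {u v : ℕ} (h : T.tree.Adj u v) : HasWalk T u v (T.weight s(u, v)) {v} :=
  ⟨[Move.traverse 0 v], ⟨⟨u, rfl, h⟩, trivial⟩, rfl, rfl, by simp [totalDistance],
    by simp [reached]⟩

theorem trans {u v w : ℕ} {c c' : ℝ} {R R' : Set ℕ} (h : HasWalk T u v c R)
    (h' : HasWalk T v w c' R') : HasWalk T u w (c + c') (R ∪ R') := by
  obtain ⟨ms, h1, h2, h3, h4, h5⟩ := h
  obtain ⟨ms', h1', h2', h3', h4', h5'⟩ := h'
  refine ⟨ms ++ ms', ?_, ?_, ?_, ?_, ?_⟩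
  · rw [legal_append, h2]; exact ⟨h1, h1'⟩
  · rw [endPos_append, h2, h2']
  · rw [numAgents_append, h3, h3']
  · rw [totalDistance_append, h2, h4, h4']
  · rintro x (hx | hx)
    · obtain ⟨m, hm, hmx⟩ := h5 x hx
      exact ⟨m, List.mem_append_left _ hm, hmx⟩
    · obtain ⟨m, hm, hmx⟩ := h5' x hx
      exact ⟨m, List.mem_append_right _ hm, hmx⟩

theorem mono {u v : ℕ} {c c' : ℝ} {R R' : Set ℕ} (h : HasWalk T u v c R) (hc : c = c')
    (hR : R' ⊆ R) : HasWalk T u v c' R' := by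
  obtain ⟨ms, h1, h2, h3, h4, h5⟩ := h
  exact ⟨ms, h1, h2, h3, h4.trans hc, fun x hx => h5 x (hR hx)⟩

theorem optCost_le {q : ℝ} (hq : 0 ≤ q) {v : ℕ} {c : ℝ} {R : Set ℕ} (h : HasWalk T T.home v c R)
    (hR : T.tree.verts ⊆ insert T.home R) : optCost q T ≤ q + c := by
  obtain ⟨ms, h1, h2, h3, h4, h5⟩ := h
  have hex : Explores T (Move.invoke :: ms) := by
    refine ⟨h1, fun x hx => ?_⟩
    rcases hR hx with rfl | hx
    · exact ⟨Move.invoke, by simp, rfl⟩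
    · obtain ⟨m, hm, hmx⟩ := h5 x hx
      exact ⟨m, List.mem_cons_of_mem _ hm, hmx⟩
  refine (_root_.optCost_le hq hex).trans_eq ?_
  simp only [cost, numAgents, h3, totalDistance, List.nil_append, h4]
  simp

end HasWalk

/-! ### A cheap tour by one agent, and the shape of the adversary's tree. -/

namespace BranchData

variable {l : ℕ} {p : BranchData l}

/-- The vertex where stage `i` begins. -/
def base (p : BranchData l) : ℕ → ℕ
  | 0 => branchVertex 0 false 0
  | i + 1 => branchVertex i (p.side i) l

/-- The vertices of branch `b` of stage `i`, beginning with the branching vertex. -/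
def branchPoint (p : BranchData l) (i : ℕ) (b : Bool) : ℕ → ℕ
  | 0 => p.base i
  | d + 1 => branchVertex i b (d + 1)

theorem par_branchPoint (i : ℕ) (b : Bool) (d : ℕ) :
    p.par (branchVertex i b (d + 1)) = p.branchPoint i b d := by
  rw [par_branchVertex]
  cases d with
  | zero => cases i <;> simp [branchPoint, base]
  | succ d => simp [branchPoint]

theorem branchPoint_adj (hl : 1 ≤ l) {n i : ℕ} (hi : i ≤ n) (b : Bool) {d : ℕ}
    (hd : d < p.branchLen i b) :
    (p.branchTree n hl).tree.Adj (p.branchPoint i b d) (p.branchPoint i b (d + 1)) := by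
  have hv : branchVertex i b (d + 1) ∈ (p.branchTree n hl).tree.verts := by
    rw [branchTree_verts, branchVertex_mem_verts]; omega
  rw [← par_branchPoint]
  exact (p.rootedBy n hl).par_adj hv (by rw [branchTree_home, Ne, branchVertex_inj]; omega)

theorem hasWalk_down (hl : 1 ≤ l) {n i : ℕ} (hi : i ≤ n) (b : Bool) {k : ℕ}
    (hk : k ≤ p.branchLen i b) :
    HasWalk (p.branchTree n hl) (p.base i) (p.branchPoint i b k) k
      {x | ∃ d, 1 ≤ d ∧ d ≤ k ∧ x = branchVertex i b d} := by
  induction k with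
  | zero => exact (HasWalk.refl _).mono (by simp) (by rintro x ⟨d, h1, h2, -⟩; omega)
  | succ k ih =>
    refine ((ih (by omega)).trans (HasWalk.of_adj (p.branchPoint_adj hl hi b hk))).mono
      (by rw [branchTree_weight]; push_cast; rfl) ?_
    rintro x ⟨d, h1, h2, rfl⟩
    rcases Nat.lt_or_ge k d with h | h
    · obtain rfl : d = k + 1 := by omega
      exact Or.inr rfl
    · exact Or.inl ⟨d, h1, h, rfl⟩

theorem hasWalk_up (hl : 1 ≤ l) {n i : ℕ} (hi : i ≤ n) (b : Bool) {k : ℕ}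
    (hk : k ≤ p.branchLen i b) :
    HasWalk (p.branchTree n hl) (p.branchPoint i b k) (p.base i) k ∅ := by
  induction k with
  | zero => exact (HasWalk.refl _).mono (by simp) (Set.empty_subset _)
  | succ k ih =>
    exact ((HasWalk.of_adj (p.branchPoint_adj hl hi b hk).symm).trans (ih (by omega))).mono
      (by rw [branchTree_weight]; push_cast; ring) (Set.empty_subset _)

/-- The agent walks to the end of the side branch and back, then along the spine segment. -/
theorem hasWalk_stage (hl : 1 ≤ l) {n i : ℕ} (hi : i ≤ n) :
    HasWalk (p.branchTree n hl) (p.base i) (p.base (i + 1)) (2 * p.len i + l)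
      {x | ∃ b d, 1 ≤ d ∧ d ≤ p.branchLen i b ∧ x = branchVertex i b d} := by
  have h1 : p.branchLen i (!p.side i) = p.len i := by simp [branchLen]
  have h2 : p.branchLen i (p.side i) = l := by simp [branchLen]
  have hend : p.branchPoint i (p.side i) l = p.base (i + 1) := by
    obtain ⟨k, rfl⟩ : ∃ k, l = k + 1 := ⟨l - 1, by omega⟩
    rfl
  rw [← hend]
  refine (((hasWalk_down hl hi (!p.side i) h1.ge).trans (hasWalk_up hl hi (!p.side i) h1.ge)).trans
    (hasWalk_down hl hi (p.side i) h2.ge)).mono (by ring) ?_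
  rintro x ⟨b, d, hd, hdl, rfl⟩
  by_cases hb : b = p.side i
  · subst hb
    exact Or.inr ⟨d, hd, h2 ▸ hdl, rfl⟩
  · obtain rfl : b = !p.side i := Bool.eq_not.2 hb
    exact Or.inl (Or.inl ⟨d, hd, h1 ▸ hdl, rfl⟩)

theorem hasWalk_stages (hl : 1 ≤ l) (n : ℕ) {k : ℕ} (hk : k ≤ n + 1) :
    HasWalk (p.branchTree n hl) (branchVertex 0 false 0) (p.base k)
      (∑ i ∈ Finset.range k, (2 * (p.len i : ℝ) + l))
      {x | ∃ i b d, i < k ∧ 1 ≤ d ∧ d ≤ p.branchLen i b ∧ x = branchVertex i b d} := by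
  induction k with
  | zero => exact (HasWalk.refl _).mono (by simp) (by rintro x ⟨i, b, d, h, -⟩; omega)
  | succ k ih =>
    refine ((ih (by omega)).trans (hasWalk_stage hl (by omega : k ≤ n))).mono
      (Finset.sum_range_succ _ _).symm ?_
    rintro x ⟨i, b, d, hi, h⟩
    rcases Nat.lt_or_ge i k with hik | hik
    · exact Or.inl ⟨i, b, d, hik, h⟩
    · obtain rfl : i = k := by omega
      exact Or.inr ⟨b, d, h⟩

theorem optCost_branchTree_le {q : ℝ} (hq : 0 ≤ q) (hl : 1 ≤ l) :
    optCost q (p.branchTree l hl) ≤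
      q + ((l + 1) * l + 2 * ∑ i ∈ Finset.Icc 1 l, (p.len i : ℝ)) := by
  refine ((p.hasWalk_stages hl l le_rfl).optCost_le hq ?_).trans_eq ?_
  · intro x hx
    obtain ⟨i, b, d, rfl⟩ := exists_eq_branchVertex x
    rw [branchTree_verts, branchVertex_mem_verts] at hx
    rcases hx with ⟨rfl, rfl, rfl⟩ | ⟨h1, h2, h3⟩
    · exact Or.inl rfl
    · exact Or.inr ⟨i, b, d, by omega, h2, h3, rfl⟩
  -- Stage 0 has no side path (`len_zero`), so it may be added to the sum.
  · have : ∑ i ∈ Finset.Icc 1 l, (p.len i : ℝ) = ∑ i ∈ Finset.range (l + 1), (p.len i : ℝ) := by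
      rw [Finset.sum_range_succ', p.len_zero, Finset.range_eq_Ico,
        Finset.sum_Ico_add' (fun i => (p.len i : ℝ)) 0 l 1]
      simp only [Nat.cast_zero, add_zero, zero_add]
      rfl
    rw [this, Finset.sum_add_distrib, ← Finset.mul_sum]
    simp
    ring

/-- The tree has an edge, so its total weight is positive. This permits division by the optimum even
if `q = 0`. -/
theorem optCost_branchTree_pos {q : ℝ} (hq : 0 ≤ q) (hl : 1 ≤ l) (n : ℕ) :
    0 < optCost q (p.branchTree n hl) := by
  refine lt_of_lt_of_le ?_ ((p.rootedBy n hl).le_optCost hq (exists_explores _))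
  refine add_pos_of_nonneg_of_pos hq (Finset.sum_pos (fun _ _ => one_pos) ?_)
  refine ⟨branchVertex 0 (p.side 0) 1, Finset.mem_erase.2 ⟨?_, Set.Finite.mem_toFinset _ |>.2 ?_⟩⟩
  · rw [branchTree_home, Ne, branchVertex_inj]; omega
  · rw [branchTree_verts, branchVertex_mem_verts]
    exact Or.inr ⟨by omega, le_rfl, by simpa [branchLen]⟩

/-! ### The adversary's trees are spine trees -/

/-- The spine vertex at distance `s` from the homebase. -/
def spinePoint (p : BranchData l) : ℕ → ℕ
  | 0 => branchVertex 0 false 0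
  | s + 1 => branchVertex (s / l) (p.side (s / l)) (s % l + 1)

/-- Depths in a segment run from 1 to `l`, not from 0, so distance and depth are both shifted by
one. -/
theorem spinePoint_eq (i : ℕ) {r : ℕ} (hr : r < l) :
    p.spinePoint (i * l + r + 1) = branchVertex i (p.side i) (r + 1) := by
  have h1 : (i * l + r) / l = i := by
    rw [Nat.mul_comm, Nat.mul_add_div (by omega), Nat.div_eq_of_lt hr, Nat.add_zero]
  have h2 : (i * l + r) % l = r := by
    rw [Nat.mul_comm, Nat.mul_add_mod, Nat.mod_eq_of_lt hr]
  rw [spinePoint, h1, h2]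

theorem exists_eq_spinePoint (hl : 1 ≤ l) (s : ℕ) : ∃ i r, r < l ∧ s = i * l + r :=
  ⟨s / l, s % l, Nat.mod_lt _ hl, by rw [Nat.mul_comm, Nat.div_add_mod]⟩

theorem spinePoint_mul (hl : 1 ≤ l) (i : ℕ) : p.spinePoint (i * l) = p.base i := by
  cases i with
  | zero => simp [spinePoint, base]
  | succ i =>
    have h : (i + 1) * l = i * l + (l - 1) + 1 := by rw [Nat.succ_mul]; omega
    rw [h, spinePoint_eq i (by omega), base, Nat.sub_add_cancel hl]

theorem spinePoint_injective (hl : 1 ≤ l) : Function.Injective p.spinePoint := by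
  intro s t h
  cases s with
  | zero =>
    cases t with
    | zero => rfl
    | succ t => have := (branchVertex_inj.1 h).2.2; omega
  | succ s =>
    cases t with
    | zero => have := (branchVertex_inj.1 h).2.2; omega
    | succ t =>
      obtain ⟨i, r, hr, rfl⟩ := exists_eq_spinePoint hl s
      obtain ⟨j, r', hr', rfl⟩ := exists_eq_spinePoint hl t
      rw [spinePoint_eq i hr, spinePoint_eq j hr', branchVertex_inj] at h
      obtain ⟨rfl, -, h⟩ := h
      omega

theorem par_spinePoint (hl : 1 ≤ l) (s : ℕ) : p.par (p.spinePoint (s + 1)) = p.spinePoint s := by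
  obtain ⟨i, r, hr, rfl⟩ := exists_eq_spinePoint hl s
  rw [spinePoint_eq i hr, par_branchPoint]
  cases r with
  | zero => exact (p.spinePoint_mul hl i).symm
  | succ r => exact (p.spinePoint_eq i (by omega)).symm

theorem spinePoint_ne_side (s : ℕ) {i d : ℕ} (hi : 1 ≤ i) :
    p.spinePoint s ≠ branchVertex i (!p.side i) d := by
  cases s with
  | zero => rw [spinePoint, Ne, branchVertex_inj]; omega
  | succ s =>
    intro h
    obtain ⟨rfl, h, -⟩ := branchVertex_inj.1 h
    simp at h

/-- The name of a vertex of the spine graph. -/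
def spineName (p : BranchData l) : SpineVertex l (fun i => p.len (i + 1)) → ℕ
  | Sum.inl s => p.spinePoint s
  | Sum.inr ⟨i, j⟩ => branchVertex (i + 1) (!p.side (i + 1)) (j + 1)

theorem spineName_injective (hl : 1 ≤ l) : Function.Injective p.spineName := by
  rintro (s | ⟨i, j⟩) (t | ⟨i', j'⟩) h
  · rw [Fin.ext (spinePoint_injective hl h)]
  · exact absurd h (spinePoint_ne_side _ (by omega))
  · exact absurd h.symm (spinePoint_ne_side _ (by omega))
  · obtain ⟨h1, -, h2⟩ := branchVertex_inj.1 h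
    obtain rfl : i = i' := Fin.ext (by omega)
    obtain rfl : j = j' := Fin.ext (by omega)
    rfl

theorem spineName_mem (hl : 1 ≤ l) (x) : p.spineName x ∈ p.verts l := by
  rcases x with s | ⟨i, j⟩
  · obtain ⟨s, hs⟩ := s
    cases s with
    | zero => exact p.home_mem_verts l
    | succ s =>
      obtain ⟨i, r, hr, rfl⟩ := exists_eq_spinePoint hl s
      change p.spinePoint (i * l + r + 1) ∈ _
      rw [spinePoint_eq i hr, branchVertex_mem_verts]
      refine Or.inr ⟨?_, by omega, by simp [branchLen]; omega⟩
      by_contra hil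
      have : (l + 1) * l ≤ i * l := Nat.mul_le_mul_right l (by omega)
      rw [Nat.mul_comm l (l + 1)] at hs
      omega
  · change branchVertex _ _ _ ∈ _
    rw [branchVertex_mem_verts]
    have := i.2
    have := j.2
    exact Or.inr ⟨by omega, by omega, by simp [branchLen]⟩

theorem exists_spineName_eq {x : ℕ} (hx : x ∈ p.verts l) : ∃ y, p.spineName y = x := by
  obtain ⟨i, b, d, rfl⟩ := exists_eq_branchVertex x
  rw [branchVertex_mem_verts] at hx
  rcases hx with ⟨rfl, rfl, rfl⟩ | ⟨hi, hd, hdl⟩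
  · exact ⟨Sum.inl 0, rfl⟩
  · unfold branchLen at hdl
    split_ifs at hdl with hb
    · subst hb
      have hle : i * l ≤ l * l := Nat.mul_le_mul_right l hi
      refine ⟨Sum.inl ⟨i * l + (d - 1) + 1, by rw [Nat.mul_succ]; omega⟩, ?_⟩
      change p.spinePoint (i * l + (d - 1) + 1) = _
      rw [spinePoint_eq i (by omega), Nat.sub_add_cancel hd]
    · have hi1 : 1 ≤ i := by
        rcases Nat.eq_zero_or_pos i with rfl | h
        · rw [p.len_zero] at hdl; omega
        · exact h
      obtain ⟨i, rfl⟩ : ∃ k, i = k + 1 := ⟨i - 1, by omega⟩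
      obtain ⟨d, rfl⟩ : ∃ k, d = k + 1 := ⟨d - 1, by omega⟩
      refine ⟨Sum.inr ⟨⟨i, by omega⟩, ⟨d, hdl⟩⟩, ?_⟩
      change branchVertex (i + 1) (!p.side (i + 1)) (d + 1) = _
      rw [branchVertex_inj]
      exact ⟨rfl, (Bool.eq_not.2 hb).symm, rfl⟩

/-- The four auxiliary facts decide when one vertex is the parent of another, by kinds: spine above
spine, spine above side, side above side, and never side above spine. -/
theorem spineGraph_adj_iff (hl : 1 ≤ l) (x y : SpineVertex l (fun i => p.len (i + 1))) :
    (spineGraph l fun i => p.len (i + 1)).Adj x y ↔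
      (p.spineName y ≠ branchVertex 0 false 0 ∧ p.par (p.spineName y) = p.spineName x) ∨
      (p.spineName x ≠ branchVertex 0 false 0 ∧ p.par (p.spineName x) = p.spineName y) := by
  have hss : ∀ s t : ℕ, (p.spinePoint t ≠ branchVertex 0 false 0 ∧
      p.par (p.spinePoint t) = p.spinePoint s) ↔ s + 1 = t := by
    intro s t
    cases t with
    | zero => simp [spinePoint]
    | succ t =>
      rw [par_spinePoint hl, (spinePoint_injective hl).eq_iff]
      simp only [spinePoint, Ne, branchVertex_inj]
      omega
  have hsb : ∀ s i j : ℕ, (branchVertex (i + 1) (!p.side (i + 1)) (j + 1) ≠ branchVertex 0 false 0 ∧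
      p.par (branchVertex (i + 1) (!p.side (i + 1)) (j + 1)) = p.spinePoint s) ↔
      s = (i + 1) * l ∧ j = 0 := by
    intro s i j
    rw [par_branchPoint]
    cases j with
    | zero =>
      rw [branchPoint, ← spinePoint_mul hl, (spinePoint_injective hl).eq_iff, Ne, branchVertex_inj]
      omega
    | succ j =>
      have := p.spinePoint_ne_side s (i := i + 1) (d := j + 1) (by omega)
      simp [branchPoint, this.symm]
  have hbb : ∀ i j i' j' : ℕ,
      (branchVertex (i' + 1) (!p.side (i' + 1)) (j' + 1) ≠ branchVertex 0 false 0 ∧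
      p.par (branchVertex (i' + 1) (!p.side (i' + 1)) (j' + 1)) =
        branchVertex (i + 1) (!p.side (i + 1)) (j + 1)) ↔ i = i' ∧ j + 1 = j' := by
    intro i j i' j'
    rw [par_branchPoint]
    cases j' with
    | zero =>
      have := p.spinePoint_ne_side ((i' + 1) * l) (i := i + 1) (d := j + 1) (by omega)
      rw [spinePoint_mul hl] at this
      simp [branchPoint, this]
    | succ j' =>
      simp only [branchPoint, branchVertex_inj, Ne]
      constructor
      · rintro ⟨-, h1, -, h2⟩; omega
      · rintro ⟨rfl, h⟩; exact ⟨by omega, rfl, rfl, by omega⟩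
  have hbs : ∀ i j t : ℕ, ¬ (p.spinePoint t ≠ branchVertex 0 false 0 ∧
      p.par (p.spinePoint t) = branchVertex (i + 1) (!p.side (i + 1)) (j + 1)) := by
    rintro i j t ⟨h1, h2⟩
    cases t with
    | zero => exact h1 rfl
    | succ t =>
      rw [par_spinePoint hl] at h2
      exact spinePoint_ne_side t (by omega) h2
  rw [spineGraph, SimpleGraph.fromRel_adj]
  rcases x with s | ⟨i, j⟩ <;> rcases y with t | ⟨i', j'⟩ <;> dsimp only [spineName]
  · rw [hss, hss]
    refine and_iff_right_of_imp fun h hst => ?_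
    rw [Sum.inl.inj hst] at h
    omega
  · rw [hsb]
    simp [hbs]
  · rw [hsb]
    simp [hbs]
  · rw [hbb, hbb]
    constructor
    · rintro ⟨-, ⟨rfl, h⟩ | ⟨rfl, h⟩⟩
      · exact Or.inl ⟨rfl, h⟩
      · exact Or.inr ⟨rfl, h⟩
    · rintro (⟨h, h'⟩ | ⟨h, h'⟩)
      · obtain rfl := Fin.ext h
        refine ⟨?_, Or.inl ⟨rfl, h'⟩⟩
        intro hh
        simp at hh
        omega
      · obtain rfl := Fin.ext h
        refine ⟨?_, Or.inr ⟨rfl, h'⟩⟩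
        intro hh
        simp at hh
        omega

theorem isSpineTree (hl : 1 ≤ l) : IsSpineTree l (p.branchTree l hl) := by
  refine ⟨hl, fun i => p.len (i + 1), fun i => ⟨p.len_pos _ (by omega), p.len_le _⟩, ?_,
    fun _ _ => rfl⟩
  let f : SpineVertex l (fun i => p.len (i + 1)) → (p.branchTree l hl).tree.verts :=
    fun x => ⟨p.spineName x, spineName_mem hl x⟩
  have hf : Function.Bijective f := by
    refine ⟨fun x y h => spineName_injective hl (congrArg Subtype.val h), fun x => ?_⟩
    obtain ⟨y, hy⟩ := exists_spineName_eq x.2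
    exact ⟨y, Subtype.ext hy⟩
  refine ⟨⟨Equiv.ofBijective f hf, ?_⟩, rfl⟩
  intro x y
  rw [spineGraph_adj_iff hl]
  change (p.branchTree l hl).tree.Adj (p.spineName x) (p.spineName y) ↔ _
  rw [(p.rootedBy l hl).adj_iff]
  exact ⟨fun h => h.2.2, fun h => ⟨spineName_mem hl x, spineName_mem hl y, h⟩⟩

end BranchData

theorem exists_spineTree_le_costOn {q : ℝ} (hq : 0 ≤ q) {ε : ℝ} (hε : 0 < ε) :
    ∃ L : ℕ, ∀ l : ℕ, L ≤ l → ∀ S : OnlineStrategy, ∃ T : WTree, IsSpineTree l T ∧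
      0 < optCost q T ∧ (2 - ε) * optCost q T ≤ S.costOn q T := by
  -- Twice the bound on the optimum exceeds the bound on the distance by `2 * q + 8 * l ≤ (2 * q +
  -- 8) * l`; this has to be at most `ε * l ^ 2`.
  obtain ⟨L, hL⟩ := exists_nat_ge ((2 * q + 8) / ε)
  refine ⟨max L 1, fun l hLl S => ?_⟩
  have hl : 1 ≤ l := (le_max_right L 1).trans hLl
  obtain ⟨p, hp⟩ := BranchData.exists_stageSplit hl S
  set T := p.branchTree l hl with hT
  have hopt : 0 < optCost q T := p.optCost_branchTree_pos hq hl l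
  refine ⟨T, p.isSpineTree hl, hopt, ?_⟩
  have hex := S.explores_moves T
  have h1 := BranchData.le_totalDistance hl hex hp
  have h2 : optCost q T ≤ _ := p.optCost_branchTree_le hq hl
  have hcost : totalDistance T [] (S.moves T) ≤ S.costOn q T :=
    le_add_of_nonneg_left (by positivity)
  have hsum : (0 : ℝ) ≤ ∑ i ∈ Finset.Icc 1 l, (p.len i : ℝ) :=
    Finset.sum_nonneg fun i _ => Nat.cast_nonneg _
  set K := ∑ i ∈ Finset.Icc 1 l, (p.len i : ℝ)
  have hl' : (1 : ℝ) ≤ l := by exact_mod_cast hl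
  have hLl' : (2 * q + 8) / ε ≤ l :=
    hL.trans (by exact_mod_cast (le_max_left L 1).trans hLl)
  rw [div_le_iff₀ hε] at hLl'
  -- For `ε ≥ 2` the left side is not positive; otherwise the upper bound on the optimum may be
  -- multiplied by `2 - ε`.
  rcases le_or_gt 2 ε with h | h
  · have : (2 - ε) * optCost q T ≤ 0 := mul_nonpos_of_nonpos_of_nonneg (by linarith) hopt.le
    exact this.trans (cost_nonneg hq hex)
  · have h3 : (2 - ε) * optCost q T ≤ (2 - ε) * (q + ((l + 1) * l + 2 * K)) :=
      mul_le_mul_of_nonneg_left h2 (by linarith)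
    have h4 : (2 * q + 8) * l ≤ l * ε * l := mul_le_mul_of_nonneg_right hLl' (by linarith)
    have h5 : q * 1 ≤ q * l := mul_le_mul_of_nonneg_left hl' hq
    have h6 : 0 ≤ ε * (q + l + 2 * K) := by positivity
    nlinarith

theorem two_le_competitiveRatio {q : ℝ} (hq : 0 ≤ q) (S : OnlineStrategy) :
    2 ≤ competitiveRatio q S := by
  refine le_of_forall_lt fun c hc => ?_
  have hctop : c ≠ ⊤ := (hc.trans (by simp)).ne
  have hc2 : c.toReal < 2 := by
    have := (ENNReal.toReal_lt_toReal hctop (by simp)).2 hc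
    simpa using this
  -- With this `ε`, `2 - ε` is the midpoint of `c` and 2, hence larger than `c`.
  obtain ⟨L, hL⟩ := exists_spineTree_le_costOn hq (ε := (2 - c.toReal) / 2) (by linarith)
  obtain ⟨T, -, hopt, hT⟩ := hL L le_rfl S
  refine lt_of_lt_of_le ?_ (le_iSup _ T)
  have hlt : c.toReal < S.costOn q T / optCost q T := by
    rw [lt_div_iff₀ hopt]
    refine lt_of_lt_of_le ?_ hT
    exact mul_lt_mul_of_pos_right (by linarith) hopt
  rw [← ENNReal.ofReal_div_of_pos hopt]
  exact (ENNReal.lt_ofReal_iff_toReal_lt hctop).2 hlt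

theorem mainTheorem2 (q : ℝ) (hq : 0 ≤ q) :
    -- depth-first search without return is an on-line strategy of competitive ratio at most 2
    (∃ next, IsDFSWithoutReturn next) ∧
    (∀ next, IsDFSWithoutReturn next →
      ∃ S : OnlineStrategy, S.next = next ∧ competitiveRatio q S ≤ 2) ∧
    -- spine trees force a ratio arbitrarily close to 2 (or more) on every on-line strategy
    (∀ ε : ℝ, 0 < ε → ∃ L : ℕ, ∀ l : ℕ, L ≤ l → ∀ S : OnlineStrategy,
      ∃ T : WTree, IsSpineTree l T ∧ (2 - ε) * optCost q T ≤ S.costOn q T) ∧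
    -- the optimal on-line competitive ratio is exactly 2
    IsLeast {r : ℝ≥0∞ | ∃ S : OnlineStrategy, competitiveRatio q S = r} 2 := by
  refine ⟨exists_isDFSWithoutReturn, fun next hn => hn.exists_onlineStrategy hq, ?_, ?_, ?_⟩
  · intro ε hε
    obtain ⟨L, hL⟩ := exists_spineTree_le_costOn hq hε
    refine ⟨L, fun l hl S => ?_⟩
    obtain ⟨T, h1, -, h2⟩ := hL l hl S
    exact ⟨T, h1, h2⟩
  · obtain ⟨next, hn⟩ := exists_isDFSWithoutReturn
    obtain ⟨S, -, hS⟩ := hn.exists_onlineStrategy hq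
    exact ⟨S, le_antisymm hS (two_le_competitiveRatio hq S)⟩
  · rintro r ⟨S, rfl⟩
    exact two_le_competitiveRatio hq S
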